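/- Let $r_1,r_2,\dots$ be i.i.d. positive random variables with law $G$, where $\mathbb{E}_G[r_1^2]<\infty$, $\mathbb{E}_G[r_1^{-2}]<\infty$, and $\inf_i r_i>0$ almost surely. For $n\ge 1$ and $\theta\in\mathbb{R}_+^n=[0,\infty)^n$, conditionally on $(r_i)$, let $X=(X_1,\dots,X_n)$ have independent coordinates $X_i\sim\mathrm{Po}(r_i\theta_i)$ and let $Y=(Y_1,\dots,Y_n)$, independent of $X$, have independent coordinates $Y_i\sim\mathrm{Po}(\theta_i)$; write $p(x\mid\theta)$ and $q(y\mid\theta)$ for their probability mass functions. For $s>0$ let $\Theta[s]=\{\theta\in\mathbb{R}_+^n:\#\{i:\theta_i>0\}\le s\}$. A predictive density $\hat q(\cdot\,;x)$ assigns to each $x\in\mathbb{N}^n$ (it may depend on $(r_i)$) a probability mass function on $\mathbb{N}^n$. Its conditional Kullback--Leibler risk and the conditional minimax risk are $$R(\theta,\hat q\mid\{r_i\})=\sum_{x,y\in\mathbb{N}^n}p(x\mid\theta)\,q(y\mid\theta)\log\frac{q(y\mid\theta)}{\hat q(y;x)},\qquad \overline{\mathcal R}(\Theta[s]\mid\{r_i\})=\inf_{\hat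 q}\sup_{\theta\in\Theta[s]}R(\theta,\hat q\mid\{r_i\}).$$ For $h,\kappa>0$ let $\Pi[h,\kappa]$ be the improper prior $\prod_{i=1}^n\{\delta_0(d\theta_i)+h\,\theta_i^{\kappa-1}1_{(0,\infty)}(\theta_i)\,d\theta_i\}$, and let $$q_{\Pi[h,\kappa]}(y\mid x)=\frac{\int q(y\mid\theta)\,p(x\mid\theta)\,d\Pi[h,\kappa](\theta)}{\int p(x\mid\theta)\,d\Pi[h,\kappa](\theta)}.$$ Let $\hat s_n=\max\{1,\#\{i\le n:X_i\ge1\}\}$ and $\hat\eta_n=\hat s_n/n$, and let $q_{\Pi[\hat\eta_n,\kappa]}$ be the plug-in predictive density obtained by replacing $h$ by $\hat\eta_n=\hat\eta_n(x)$. Proposition. Fix $\kappa\in(0,1]$. Then $q_{\Pi[\hat\eta_n,\kappa]}$, which does not depend on the sparsity level, is adaptive in the asymptotically minimax sense: for every real sequence $(s_n)_{n\ge2}$ with $s_n\in[1,n)$, $\sup_n s_n/n<1$ and $s_n/n\to0$, $$\operatorname*{plim}_{n\to\infty}\ \frac{\overline{\mathcal R}(\Theta[s_n]\mid\{r_i\})}{\sup_{\theta\in\Theta[s_n]}R(\theta,q_{\Pi[\hat\eta_n,\kappa]}\mid\{r_i\})}=1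 ,$$ where plim is the limit in probability with respect to the law of $(r_i)$. -/

import Mathlib

open MeasureTheory ProbabilityTheory Filter Topology Set
open scoped ENNReal NNReal

noncomputable section

namespace SparsePoisson

variable {n : ℕ}

/-- The law on `ℕⁿ` of independent Poisson variables, the `i`-th one with mean `m i`
(only used for `m i ≥ 0`). -/
def poissonLaw (m : Fin n → ℝ) : Measure (Fin n → ℕ) :=
  Measure.pi fun i => poissonMeasure (m i).toNNReal

/-- The exact sparse parameter space `Θ[s] = {θ ∈ ℝ₊ⁿ : ‖θ‖₀ ≤ s}`. -/
def sparseSpace (n : ℕ) (s : ℝ) : Set (Fin n → ℝ) :=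
  {θ | (∀ i, 0 ≤ θ i) ∧ ((Finset.univ.filter fun i => 0 < θ i).card : ℝ) ≤ s}

/-- The Kullback--Leibler risk at `θ`, given the ratios `r`, of a predictive law `Q`: the
observation `X` has independent `Po(r i * θ i)` coordinates, the future `Y` (independent of `X`)
has independent `Po(θ i)` coordinates, and the loss is the Kullback--Leibler divergence of
`Q X` from the law of `Y`. -/
def klRisk (r θ : Fin n → ℝ) (Q : (Fin n → ℕ) → Measure (Fin n → ℕ)) : ℝ≥0∞ :=
  ∫⁻ x, InformationTheory.klDiv (poissonLaw θ) (Q x) ∂(poissonLaw fun i => r i * θ i)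

/-- The largest risk of `Q` over `Θ[s]`, given the ratios `r`. -/
def maxRisk (r : Fin n → ℝ) (s : ℝ) (Q : (Fin n → ℕ) → Measure (Fin n → ℕ)) : ℝ≥0∞ :=
  ⨆ θ ∈ sparseSpace n s, klRisk r θ Q

/-- The minimax risk over `Θ[s]`, given the ratios `r`; the infimum runs over all predictive
densities, which may depend on `r`. -/
def minimaxRisk (r : Fin n → ℝ) (s : ℝ) : ℝ≥0∞ :=
  ⨅ q : (Fin n → ℕ) → PMF (Fin n → ℕ), maxRisk r s fun x => (q x).toMeasure

/-- One coordinate `δ₀(dλ) + h λ ^ (κ - 1) 1_{(0,∞)}(λ) dλ` of the spike-and-slab prior. -/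
def spikeSlabCoord (h κ : ℝ) : Measure ℝ :=
  Measure.dirac 0 +
    (volume.restrict (Ioi (0 : ℝ))).withDensity fun t => ENNReal.ofReal (h * t ^ (κ - 1))

/-- The improper spike-and-slab prior `Π[h, κ]` on `ℝ₊ⁿ`. -/
def spikeSlabPrior (n : ℕ) (h κ : ℝ) : Measure (Fin n → ℝ) :=
  Measure.pi fun _ => spikeSlabCoord h κ

/-- The Bayes predictive density
`q_Π(y ∣ x) = ∫ q(y ∣ θ) p(x ∣ θ) dΠ(θ) / ∫ p(x ∣ θ) dΠ(θ)` for a possibly improper prior `Π`,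
where `p(x ∣ θ)` and `q(y ∣ θ)` are the densities of `X` and of `Y`. -/
def bayesDensity (prior : Measure (Fin n → ℝ)) (r : Fin n → ℝ) (x y : Fin n → ℕ) : ℝ≥0∞ :=
  (∫⁻ θ, poissonLaw θ {y} * poissonLaw (fun i => r i * θ i) {x} ∂prior) /
    ∫⁻ θ, poissonLaw (fun i => r i * θ i) {x} ∂prior

/-- The law on `ℕⁿ` with density `bayesDensity prior r x`. -/
def bayesPredictive (prior : Measure (Fin n → ℝ)) (r : Fin n → ℝ) (x : Fin n → ℕ) :
    Measure (Fin n → ℕ) :=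
  Measure.count.withDensity (bayesDensity prior r x)

/-- The sparsity estimate `ŝ = max {1, #{i : x i ≥ 1}}`. -/
def sHat (x : Fin n → ℕ) : ℕ :=
  max 1 (Finset.univ.filter fun i => 1 ≤ x i).card

/-- The plug-in predictive law `q_{Π[ŝ / n, κ]}`; it does not use the true sparsity. -/
def adaptivePredictive (κ : ℝ) (r : Fin n → ℝ) (x : Fin n → ℕ) : Measure (Fin n → ℕ) :=
  bayesPredictive (spikeSlabPrior n ((sHat x : ℝ) / n) κ) r x

end SparsePoisson

end

noncomputable section

namespace SparsePoisson

open scoped Nat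

/-! Let `r₀` be the essential infimum of `G`, which is positive, put `C = sup_{t ≥ 0} e^{-r₀ t}(1 -
e^{-t})` and `k = ⌊s⌋`. The minimax risk and the maximal risk of the plug-in density are both `k C
log(n/k)` to leading order, with probability tending to one. The reason is that a signal `t` costs
about `log(n/k)` only when its past count is zero and its future count is positive, an event of
probability `e^{-r t}(1 - e^{-t}) ≤ C`.

Upper bound (`maxRisk_adaptivePredictive_le`): the plug-in density pays `log(1/h)` on that event
only. Where the past count is positive, the factor `h` cancels and a Gamma posterior gives loss
`O(1)` in the mean, uniformly in the signal. Null coordinates pay `O(h)` each, hence `O(k)`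
together. Replacing `log(n/k)` by `log(n/ŝ)` costs at most a multiple of `k/ŝ`, and a Chernoff bound
(`lintegral_div_sHat_le`) keeps its weighted mean `O(k)`.

Lower bound (`ofReal_le_minimaxRisk_of_card`): hide one spike uniformly in each of `k` blocks of
length `L ≈ c n / k`, built from coordinates with ratio at most `r₀ + δ`. If a block shows no past
count, the spike's position is nearly uniform over `L` places, so a future count there costs about
`log L = log(n/k) + O(1)`.

The strong law supplies the `c n` coordinates with ratio near `r₀`, and `s/n → 0` makes the `O(k)`
terms negligible (`minimaxRisk_div_maxRisk_mem_Icc`). -/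

theorem lintegral_pi_fin_prod {n : ℕ} {E : Type*} [MeasurableSpace E] (μ : Fin n → Measure E)
    [∀ i, SigmaFinite (μ i)] (f : Fin n → E → ℝ≥0∞) (hf : ∀ i, Measurable (f i)) :
    ∫⁻ x, ∏ i, f i (x i) ∂(Measure.pi μ) = ∏ i, ∫⁻ x, f i x ∂(μ i) := by
  induction n with
  | zero => simp
  | succ n ih =>
    have hmp := measurePreserving_piFinSuccAbove μ 0
    have h1 : ∫⁻ x, ∏ i, f i (x i) ∂(Measure.pi μ) =
        ∫⁻ z : E × (Fin n → E), f 0 z.1 * ∏ i : Fin n, f i.succ (z.2 i)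
          ∂((μ 0).prod (Measure.pi fun j => μ (Fin.succAbove 0 j))) := by
      rw [← hmp.lintegral_comp_emb (MeasurableEquiv.measurableEmbedding _)]
      refine lintegral_congr fun x => ?_
      rw [Fin.prod_univ_succ]
      rfl
    have hm : Measurable fun z : Fin n → E => ∏ i : Fin n, f i.succ (z i) :=
      Finset.measurable_fun_prod _ fun i _ => (hf i.succ).comp (measurable_pi_apply i)
    rw [h1, lintegral_prod_mul (f := f 0) (g := fun z : Fin n → E => ∏ i : Fin n, f i.succ (z i))
      (hf 0).aemeasurable hm.aemeasurable, Fin.prod_univ_succ]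
    congr 1
    exact ih _ _ fun i => hf i.succ

/-! ### Variational bounds for the Kullback–Leibler divergence -/

section KL

open InformationTheory

variable {α : Type*} [MeasurableSpace α]

/-- The hypothesis says that the log-likelihood ratio is at most `g`. It allows risk bounds from
pointwise lower bounds on the predictive mass, without its exact logarithm. -/
theorem klDiv_le_ofReal_integral [Countable α] [MeasurableSingletonClass α] (μ ν : Measure α)
    [IsProbabilityMeasure μ] [IsProbabilityMeasure ν] (g : α → ℝ) (hg : Integrable g μ)
    (h : ∀ y, ENNReal.ofReal (Real.exp (-g y)) * μ {y} ≤ ν {y}) :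
    klDiv μ ν ≤ ENNReal.ofReal (∫ y, g y ∂μ) := by
  have hac : μ ≪ ν := by
    refine Measure.AbsolutelyContinuous.mk fun s _ hs => ?_
    rw [← Measure.tsum_indicator_apply_singleton μ s (Set.to_countable s).measurableSet,
      ENNReal.tsum_eq_zero]
    intro y
    by_cases hy : y ∈ s
    · have h0 : ν {y} = 0 := measure_mono_null (by simpa using hy) hs
      have := h y
      rw [h0, nonpos_iff_eq_zero, mul_eq_zero] at this
      rcases this with h1 | h1
      · exact absurd h1 (by simp [Real.exp_pos])
      · simp [hy, h1]
    · simp [hy]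
  set ρ : α → ℝ := fun y => (μ.rnDeriv ν y).toReal with hρ
  have hpt : ∀ᵐ y ∂ν, klFun (ρ y) ≤ ρ y * g y + 1 - ρ y := by
    filter_upwards [μ.rnDeriv_lt_top ν, ae_iff_of_countable.2 (fun y hy => hy)]
      with y hy hy0
    have h1 : μ {y} = μ.rnDeriv ν y * ν {y} := by
      conv_lhs => rw [← Measure.withDensity_rnDeriv_eq μ ν hac]
      rw [withDensity_apply _ (measurableSet_singleton y), lintegral_singleton]
    have h2 := h y
    rw [h1, ← mul_assoc] at h2
    have h3 : ENNReal.ofReal (Real.exp (-g y)) * μ.rnDeriv ν y ≤ 1 := by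
      by_contra hcon
      push Not at hcon
      have := ENNReal.mul_lt_mul_left hy0 (measure_ne_top ν _) hcon
      rw [one_mul] at this
      exact absurd h2 (not_le.2 this)
    have h4 : Real.exp (-g y) * ρ y ≤ 1 := by
      have := ENNReal.toReal_mono ENNReal.one_ne_top h3
      rwa [ENNReal.toReal_mul, ENNReal.toReal_ofReal (Real.exp_pos _).le, ENNReal.toReal_one]
        at this
    have h5 : 0 ≤ ρ y := ENNReal.toReal_nonneg
    rw [klFun_apply]
    rcases h5.eq_or_lt with h6 | h6
    · rw [← h6]; simp
    · have : Real.log (ρ y) ≤ g y := by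
        rw [Real.log_le_iff_le_exp h6]
        rw [Real.exp_neg, inv_mul_le_iff₀ (Real.exp_pos _), mul_one] at h4
        exact h4
      nlinarith [mul_le_mul_of_nonneg_left this h5]
  have hint : Integrable (fun y => ρ y * g y) ν := by
    simpa [smul_eq_mul] using (integrable_rnDeriv_smul_iff (f := g) hac).2 hg
  have hintρ : Integrable ρ ν := Measure.integrable_toReal_rnDeriv
  have hval : ∫ y, (ρ y * g y + 1 - ρ y) ∂ν = ∫ y, g y ∂μ := by
    have e1 : ∫ y, ρ y * g y ∂ν = ∫ y, g y ∂μ := by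
      simpa [smul_eq_mul] using integral_rnDeriv_smul (f := g) hac
    have e2 : ∫ y, ρ y ∂ν = 1 := by
      rw [Measure.integral_toReal_rnDeriv hac]; simp
    have e3 : ∫ y, (ρ y * g y + 1 - ρ y) ∂ν = ∫ y, (ρ y * g y + 1) ∂ν - ∫ y, ρ y ∂ν :=
      integral_sub (hint.add (integrable_const 1)) hintρ
    rw [e3, integral_add hint (integrable_const 1), e1, e2]
    simp
  rw [klDiv_eq_lintegral_klFun_of_ac hac, ← hval, ofReal_integral_eq_lintegral_ofReal]
  · exact lintegral_mono_ae (hpt.mono fun y hy => ENNReal.ofReal_le_ofReal hy)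
  · exact (hint.add (integrable_const 1)).sub hintρ
  · exact hpt.mono fun y hy => (klFun_nonneg ENNReal.toReal_nonneg).trans hy

/-- Fenchel–Young for the exponential, `ρ f + 1 ≤ klFun ρ + e^f`, integrated against `ν`. This
unnormalised Donsker–Varadhan inequality drives the lower bound; when the divergence is infinite it
is trivial. -/
theorem ofReal_integral_add_one_le_klDiv_add (μ ν : Measure α)
    [IsProbabilityMeasure μ] [IsProbabilityMeasure ν] (f : α → ℝ)
    (hfμ : Integrable f μ) (hfν : Integrable (fun y => Real.exp (f y)) ν) :
    ENNReal.ofReal (∫ y, f y ∂μ + 1) ≤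
      klDiv μ ν + ∫⁻ y, ENNReal.ofReal (Real.exp (f y)) ∂ν := by
  by_cases hac : μ ≪ ν
  swap
  · simp [klDiv_of_not_ac hac]
  by_cases hllr : Integrable (llr μ ν) μ
  swap
  · simp [klDiv_of_not_integrable hllr]
  set ρ : α → ℝ := fun y => (μ.rnDeriv ν y).toReal with hρ
  have hpt : ∀ y, ρ y * f y + 1 ≤ klFun (ρ y) + Real.exp (f y) := by
    intro y
    have h5 : 0 ≤ ρ y := ENNReal.toReal_nonneg
    rw [klFun_apply]
    rcases h5.eq_or_lt with h6 | h6
    · rw [← h6]; simp [Real.exp_nonneg]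
    · have h7 := Real.add_one_le_exp (f y - Real.log (ρ y))
      rw [Real.exp_sub, Real.exp_log h6, le_div_iff₀ h6] at h7
      nlinarith
  have hint : Integrable (fun y => ρ y * f y) ν := by
    simpa [smul_eq_mul] using (integrable_rnDeriv_smul_iff (f := f) hac).2 hfμ
  have hkl : Integrable (fun y => klFun (ρ y)) ν := (integrable_klFun_rnDeriv_iff hac).2 hllr
  have e1 : ∫ y, ρ y * f y ∂ν = ∫ y, f y ∂μ := by
    simpa [smul_eq_mul] using integral_rnDeriv_smul (f := f) hac
  have e2 : ∫ y, f y ∂μ + 1 = ∫ y, (ρ y * f y + 1) ∂ν := by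
    rw [integral_add hint (integrable_const 1), e1]; simp
  rw [klDiv_eq_lintegral_klFun_of_ac hac, e2,
    ← lintegral_add_left (by fun_prop)]
  refine (ENNReal.ofReal_le_ofReal (integral_mono (hint.add (integrable_const 1))
    (hkl.add hfν) hpt)).trans ?_
  rw [ofReal_integral_eq_lintegral_ofReal (hkl.add hfν)
    (ae_of_all _ fun y => add_nonneg (klFun_nonneg ENNReal.toReal_nonneg) (Real.exp_nonneg _))]
  exact lintegral_mono fun y => ENNReal.ofReal_add_le

end KL

/-! ### Gamma integrals -/

/-- The integral `∫₀^∞ t ^ (a - 1) * exp (-(ρ * t)) dt`. -/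
def gammaInt (a ρ : ℝ) : ℝ := (1 / ρ) ^ a * Real.Gamma a

theorem gammaInt_pos {a ρ : ℝ} (ha : 0 < a) (hρ : 0 < ρ) : 0 < gammaInt a ρ := by
  have := Real.Gamma_pos_of_pos ha
  unfold gammaInt; positivity

theorem gammaInt_add_one {a ρ : ℝ} (ha : 0 < a) (hρ : 0 < ρ) :
    gammaInt (a + 1) ρ = a / ρ * gammaInt a ρ := by
  unfold gammaInt
  rw [Real.Gamma_add_one ha.ne', Real.rpow_add (by positivity), Real.rpow_one]
  ring

theorem gammaInt_anti {a ρ ρ' : ℝ} (ha : 0 < a) (hρ : 0 < ρ) (h : ρ ≤ ρ') :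
    gammaInt a ρ' ≤ gammaInt a ρ := by
  have := Real.Gamma_pos_of_pos ha
  have : 0 < ρ' := by linarith
  unfold gammaInt
  gcongr

theorem integral_eq_gammaInt {a ρ : ℝ} (ha : 0 < a) (hρ : 0 < ρ) :
    ∫ t in Ioi (0 : ℝ), t ^ (a - 1) * Real.exp (-(ρ * t)) = gammaInt a ρ :=
  Real.integral_rpow_mul_exp_neg_mul_Ioi ha hρ

theorem integrableOn_rpow_mul_exp {a ρ : ℝ} (ha : 0 < a) (hρ : 0 < ρ) :
    IntegrableOn (fun t : ℝ => t ^ (a - 1) * Real.exp (-(ρ * t))) (Ioi 0) := by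
  by_contra h
  have h1 := integral_eq_gammaInt ha hρ
  rw [integral_undef h] at h1
  exact (gammaInt_pos ha hρ).ne h1

theorem lintegral_eq_gammaInt {a ρ : ℝ} (ha : 0 < a) (hρ : 0 < ρ) :
    ∫⁻ t in Ioi (0 : ℝ), ENNReal.ofReal (t ^ (a - 1) * Real.exp (-(ρ * t))) =
      ENNReal.ofReal (gammaInt a ρ) := by
  rw [← integral_eq_gammaInt ha hρ,
    ofReal_integral_eq_lintegral_ofReal (integrableOn_rpow_mul_exp ha hρ)]
  filter_upwards [ae_restrict_mem measurableSet_Ioi] with t ht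
  have : (0 : ℝ) < t := ht
  positivity

/-- Lower bound for a Gamma integral from Jensen's inequality. -/
theorem gammaInt_shift_ge {a ρ : ℝ} (ha : 1 < a) (hρ : 0 < ρ) (y : ℕ) :
    ((a - 1) / ρ) ^ y * Real.exp (-(a / ρ)) * gammaInt a ρ ≤ gammaInt (a + y) (ρ + 1) := by
  have ha0 : 0 < a := by linarith
  have ha1 : 0 < a - 1 := by linarith
  set m := (a - 1) / ρ with hm
  have hm0 : 0 < m := by positivity
  set c := a / ρ with hc
  have i0 := integrableOn_rpow_mul_exp ha0 hρ
  have i1 := integrableOn_rpow_mul_exp ha1 hρ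
  have i2 := integrableOn_rpow_mul_exp (a := a + 1) (by linarith) hρ
  have i3 := integrableOn_rpow_mul_exp (a := a + y) (ρ := ρ + 1) (by positivity) (by linarith)
  have e1 : gammaInt a ρ = m * gammaInt (a - 1) ρ := by
    have := gammaInt_add_one ha1 hρ
    rwa [sub_add_cancel] at this
  have e2 : gammaInt (a + 1) ρ = c * gammaInt a ρ := gammaInt_add_one ha0 hρ
  -- The integrand is the minorant of `t ^ y * exp (-t)` given by `exp u ≥ 1 + u` with `u = y (1 -
  -- m/t) - (t - c)`. Under the Gamma law of shape `a` and rate `ρ`, `1/t` has mean `1/m` and `t`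
  -- has mean `c`, so both corrections integrate to zero.
  have hval : ∫ t in Ioi (0 : ℝ), (m ^ y * Real.exp (-c)) *
      ((1 + y + c) * (t ^ (a - 1) * Real.exp (-(ρ * t))) -
        (y * m) * (t ^ (a - 1 - 1) * Real.exp (-(ρ * t))) -
        t ^ (a + 1 - 1) * Real.exp (-(ρ * t))) = m ^ y * Real.exp (-c) * gammaInt a ρ := by
    have hs : IntegrableOn (fun t : ℝ => (1 + y + c) * (t ^ (a - 1) * Real.exp (-(ρ * t))) -
        (y * m) * (t ^ (a - 1 - 1) * Real.exp (-(ρ * t)))) (Ioi 0) :=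
      (i0.const_mul _).sub (i1.const_mul _)
    rw [integral_const_mul, integral_sub hs i2, integral_sub (i0.const_mul _) (i1.const_mul _), integral_const_mul, integral_const_mul,
      integral_eq_gammaInt ha0 hρ, integral_eq_gammaInt ha1 hρ,
      integral_eq_gammaInt (by linarith) hρ, e2]
    rw [mul_assoc (y : ℝ) m, ← e1]
    ring
  rw [← hval, ← integral_eq_gammaInt (by positivity) (by linarith)]
  refine setIntegral_mono_on ((((i0.const_mul _).sub (i1.const_mul _)).sub i2).const_mul _) i3
    measurableSet_Ioi fun t ht => ?_
  have ht0 : (0 : ℝ) < t := ht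
  have p1 : t ^ (a - 1) = t ^ (a - 1 - 1) * t := by
    rw [← Real.rpow_add_one ht0.ne']; ring_nf
  have p2 : t ^ (a + 1 - 1) = t ^ (a - 1) * t := by
    rw [← Real.rpow_add_one ht0.ne']; ring_nf
  have p3 : t ^ (a + y - 1) = t ^ (a - 1) * t ^ y := by
    rw [← Real.rpow_add_natCast ht0.ne']; ring_nf
  have p4 : Real.exp (-((ρ + 1) * t)) = Real.exp (-(ρ * t)) * Real.exp (-t) := by
    rw [← Real.exp_add]; ring_nf
  have key : m ^ y * Real.exp (-c) * (1 + y + c - y * m / t - t) ≤ t ^ y * Real.exp (-t) := by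
    have h1 : Real.exp (y * (1 - m / t)) * m ^ y ≤ t ^ y := by
      have h2 : Real.exp (1 - m / t) * m ≤ t := by
        have h3 := Real.add_one_le_exp (m / t - 1)
        have h4 : m / t ≤ Real.exp (m / t - 1) := by linarith
        have h5 : Real.exp (1 - m / t) = (Real.exp (m / t - 1))⁻¹ := by
          rw [← Real.exp_neg]; ring_nf
        rw [h5, inv_mul_le_iff₀ (Real.exp_pos _)]
        rwa [div_le_iff₀ ht0] at h4
      rw [Real.exp_nat_mul, ← mul_pow]
      exact pow_le_pow_left₀ (by positivity) h2 y
    have h6 := Real.add_one_le_exp (y * (1 - m / t) - (t - c))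
    have h7 : Real.exp (y * (1 - m / t) - (t - c)) =
        Real.exp (y * (1 - m / t)) * Real.exp (-t) * Real.exp c := by
      rw [← Real.exp_add, ← Real.exp_add]; ring_nf
    rw [h7] at h6
    have h8 : Real.exp (-c) * Real.exp c = 1 := by rw [← Real.exp_add]; simp
    calc m ^ y * Real.exp (-c) * (1 + y + c - y * m / t - t)
        = m ^ y * Real.exp (-c) * (y * (1 - m / t) - (t - c) + 1) := by ring
      _ ≤ m ^ y * Real.exp (-c) *
          (Real.exp (y * (1 - m / t)) * Real.exp (-t) * Real.exp c) := by gcongr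
      _ = (Real.exp (-c) * Real.exp c) * (Real.exp (y * (1 - m / t)) * m ^ y) *
          Real.exp (-t) := by ring
      _ ≤ _ := by rw [h8, one_mul]; gcongr
  have hfac : 0 ≤ t ^ (a - 1) * Real.exp (-(ρ * t)) := by positivity
  have := mul_le_mul_of_nonneg_left key hfac
  rw [p3, p4]
  calc _ = t ^ (a - 1) * Real.exp (-(ρ * t)) *
        (m ^ y * Real.exp (-c) * (1 + y + c - y * m / t - t)) := by
        rw [p2, p1]; field_simp
    _ ≤ _ := this
    _ = _ := by ring

/-- Lower bound for a Gamma integral by restriction to `[θ, 2θ]`. -/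
theorem gammaInt_ge_window {κ ρ θ : ℝ} (hκ : κ ∈ Ioc (0 : ℝ) 1) (hρ : 0 < ρ) (hθ : 0 < θ)
    (y : ℕ) :
    θ ^ y * Real.exp (-(2 * ρ * θ)) * (min θ 1 / 2) ≤ gammaInt (κ + y) ρ := by
  have hκ0 := hκ.1
  have i3 := integrableOn_rpow_mul_exp (a := κ + y) (ρ := ρ) (by positivity) hρ
  rw [← integral_eq_gammaInt (by positivity) hρ]
  have hsub : Icc θ (2 * θ) ⊆ Ioi 0 := fun t ht => hθ.trans_le ht.1
  refine le_trans ?_ (setIntegral_mono_set i3 ?_ hsub.eventuallyLE)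
  · have hconst : ∫ _ in Icc θ (2 * θ), ((2 * θ) ^ (κ - 1) * θ ^ y * Real.exp (-(2 * ρ * θ))) =
        θ * ((2 * θ) ^ (κ - 1) * θ ^ y * Real.exp (-(2 * ρ * θ))) := by
      rw [setIntegral_const, smul_eq_mul, Real.volume_real_Icc_of_le (by linarith)]
      ring
    refine le_trans ?_ (le_trans hconst.ge (setIntegral_mono_on (integrableOn_const (by simp))
      (i3.mono_set hsub) measurableSet_Icc fun t ht => ?_))
    -- Uses `κ ∈ (0, 1]`: then `2 ^ (κ - 1) ≥ 1/2` and `θ ^ κ ≥ min θ 1`.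
    · have h1 : min θ 1 / 2 ≤ θ * (2 * θ) ^ (κ - 1) := by
        rw [Real.mul_rpow (by norm_num) hθ.le]
        have h2 : (1 / 2 : ℝ) ≤ 2 ^ (κ - 1) := by
          rw [show (1 / 2 : ℝ) = 2 ^ (-1 : ℝ) by rw [Real.rpow_neg_one]; norm_num]
          exact Real.rpow_le_rpow_of_exponent_le (by norm_num) (by linarith)
        have h3 : min θ 1 ≤ θ * θ ^ (κ - 1) := by
          rw [mul_comm, ← Real.rpow_add_one hθ.ne', sub_add_cancel]
          rcases le_total θ 1 with h | h
          · rw [min_eq_left h]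
            simpa using Real.rpow_le_rpow_of_exponent_ge hθ h hκ.2
          · rw [min_eq_right h]
            exact Real.one_le_rpow h hκ0.le
        have h4 : 0 ≤ θ * θ ^ (κ - 1) := by positivity
        nlinarith
      calc θ ^ y * Real.exp (-(2 * ρ * θ)) * (min θ 1 / 2)
          ≤ θ ^ y * Real.exp (-(2 * ρ * θ)) * (θ * (2 * θ) ^ (κ - 1)) := by gcongr
        _ = _ := by ring
    · have ht0 : 0 < t := hsub ht
      have p3 : t ^ (κ + y - 1) = t ^ (κ - 1) * t ^ y := by
        rw [← Real.rpow_add_natCast ht0.ne']; ring_nf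
      rw [p3]
      have q1 : (2 * θ) ^ (κ - 1) ≤ t ^ (κ - 1) :=
        Real.rpow_le_rpow_of_nonpos ht0 ht.2 (by linarith [hκ.2])
      have q2 : θ ^ y ≤ t ^ y := pow_le_pow_left₀ hθ.le ht.1 y
      have q3 : -(2 * ρ * θ) ≤ -(ρ * t) := by nlinarith [ht.2]
      gcongr
  · filter_upwards [ae_restrict_mem measurableSet_Ioi] with t ht
    have : (0 : ℝ) < t := ht
    simp only [Pi.zero_apply]
    positivity

/-! ### Poisson masses and the product form of the Bayes predictive density -/

/-- The Poisson probability mass function with mean `m`. -/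
def poissonMass (m : ℝ) (k : ℕ) : ℝ := Real.exp (-m) * m ^ k / k !

theorem poissonMass_nonneg {m : ℝ} (hm : 0 ≤ m) (k : ℕ) : 0 ≤ poissonMass m k := by
  unfold poissonMass; positivity

theorem poissonMeasure_toNNReal_singleton {m : ℝ} (hm : 0 ≤ m) (k : ℕ) :
    poissonMeasure m.toNNReal {k} = ENNReal.ofReal (poissonMass m k) := by
  rw [poissonMeasure_singleton, Real.coe_toNNReal _ hm, poissonMass]

instance {n : ℕ} (m : Fin n → ℝ) : IsProbabilityMeasure (poissonLaw m) := by
  unfold poissonLaw; infer_instance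

theorem poissonLaw_singleton {n : ℕ} (m : Fin n → ℝ) (x : Fin n → ℕ) :
    poissonLaw m {x} = ∏ i, poissonMeasure (m i).toNNReal {x i} :=
  Measure.pi_singleton _ _

theorem measurePreserving_eval_poissonLaw {n : ℕ} (m : Fin n → ℝ) (i : Fin n) :
    MeasurePreserving (fun x : Fin n → ℕ => x i) (poissonLaw m) (poissonMeasure (m i).toNNReal) :=
  measurePreserving_eval _ i

instance (h κ : ℝ) : SigmaFinite (spikeSlabCoord h κ) := by
  unfold spikeSlabCoord; infer_instance

theorem measurable_poissonMeasure_singleton (r : ℝ) (k : ℕ) :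
    Measurable fun t : ℝ => poissonMeasure (r * t).toNNReal {k} := by
  simp_rw [poissonMeasure_singleton]
  fun_prop

/-- The marginal mass at `x` of one coordinate under the spike-and-slab prior. -/
def marginalMass (h κ r : ℝ) (x : ℕ) : ℝ :=
  (if x = 0 then 1 else 0) + h * r ^ x / x ! * gammaInt (x + κ) r

/-- The joint marginal mass at `(x, y)` of one coordinate under the spike-and-slab prior. -/
def jointMass (h κ r : ℝ) (x y : ℕ) : ℝ :=
  (if x = 0 ∧ y = 0 then 1 else 0) + h * r ^ x / (x ! * y !) * gammaInt (x + κ + y) (r + 1)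

theorem marginalMass_pos {h κ r : ℝ} (hh : 0 < h) (hκ : 0 < κ) (hr : 0 < r) (x : ℕ) :
    0 < marginalMass h κ r x := by
  have := gammaInt_pos (a := x + κ) (by positivity) hr
  unfold marginalMass
  split_ifs <;> positivity

theorem jointMass_pos {h κ r : ℝ} (hh : 0 < h) (hκ : 0 < κ) (hr : 0 < r) (x y : ℕ) :
    0 < jointMass h κ r x y := by
  have := gammaInt_pos (a := x + κ + y) (ρ := r + 1) (by positivity) (by positivity)
  unfold jointMass
  split_ifs <;> positivity

theorem lintegral_spikeSlabCoord {h κ : ℝ} {F : ℝ → ℝ≥0∞} (hF : Measurable F) :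
    ∫⁻ t, F t ∂(spikeSlabCoord h κ) =
      F 0 + ∫⁻ t in Ioi (0 : ℝ), ENNReal.ofReal (h * t ^ (κ - 1)) * F t := by
  rw [spikeSlabCoord, lintegral_add_measure, lintegral_dirac' _ hF,
    lintegral_withDensity_eq_lintegral_mul _ (by fun_prop) hF]
  rfl

theorem lintegral_spikeSlabCoord_marginal {h κ r : ℝ} (hh : 0 < h) (hκ : 0 < κ) (hr : 0 < r)
    (x : ℕ) :
    ∫⁻ t, poissonMeasure (r * t).toNNReal {x} ∂(spikeSlabCoord h κ) =
      ENNReal.ofReal (marginalMass h κ r x) := by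
  have ha : (0 : ℝ) < x + κ := by positivity
  have hg := gammaInt_pos ha hr
  rw [lintegral_spikeSlabCoord (measurable_poissonMeasure_singleton r x), marginalMass,
    ENNReal.ofReal_add (by split_ifs <;> norm_num) (by positivity)]
  congr 1
  · rw [poissonMeasure_toNNReal_singleton (by simp), poissonMass]
    by_cases hx : x = 0 <;> simp [hx]
  · rw [ENNReal.ofReal_mul (by positivity), ← lintegral_eq_gammaInt ha hr,
      ← lintegral_const_mul' _ _ (by simp)]
    refine setLIntegral_congr_fun measurableSet_Ioi fun t ht => ?_
    have ht0 : (0 : ℝ) < t := ht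
    have p3 : t ^ (x + κ - 1) = t ^ (κ - 1) * t ^ x := by
      rw [← Real.rpow_add_natCast ht0.ne']; ring_nf
    rw [poissonMeasure_toNNReal_singleton (by positivity), ← ENNReal.ofReal_mul (by positivity),
      ← ENNReal.ofReal_mul (by positivity), poissonMass, p3, mul_pow]
    congr 1
    ring

theorem lintegral_spikeSlabCoord_joint {h κ r : ℝ} (hh : 0 < h) (hκ : 0 < κ) (hr : 0 < r)
    (x y : ℕ) :
    ∫⁻ t, poissonMeasure t.toNNReal {y} * poissonMeasure (r * t).toNNReal {x}
      ∂(spikeSlabCoord h κ) = ENNReal.ofReal (jointMass h κ r x y) := by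
  have ha : (0 : ℝ) < x + κ + y := by positivity
  have hr1 : 0 < r + 1 := by linarith
  have hg := gammaInt_pos ha hr1
  have hm := measurable_poissonMeasure_singleton 1 y
  simp only [one_mul] at hm
  rw [lintegral_spikeSlabCoord
    (show Measurable fun t : ℝ => poissonMeasure t.toNNReal {y} * poissonMeasure (r * t).toNNReal {x}
      from hm.mul (measurable_poissonMeasure_singleton r x)), jointMass,
    ENNReal.ofReal_add (by split_ifs <;> norm_num) (by positivity)]
  congr 1
  · rw [poissonMeasure_toNNReal_singleton (by simp), poissonMeasure_toNNReal_singleton (by simp),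
      poissonMass, poissonMass]
    by_cases hx : x = 0 <;> by_cases hy : y = 0 <;> simp [hx, hy]
  · rw [ENNReal.ofReal_mul (by positivity), ← lintegral_eq_gammaInt ha hr1,
      ← lintegral_const_mul' _ _ (by simp)]
    refine setLIntegral_congr_fun measurableSet_Ioi fun t ht => ?_
    have ht0 : (0 : ℝ) < t := ht
    have p3 : t ^ (x + κ + y - 1) = t ^ (κ - 1) * t ^ x * t ^ y := by
      rw [← Real.rpow_add_natCast ht0.ne', ← Real.rpow_add_natCast ht0.ne']; ring_nf
    have p4 : Real.exp (-((r + 1) * t)) = Real.exp (-(r * t)) * Real.exp (-t) := by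
      rw [← Real.exp_add]; ring_nf
    rw [poissonMeasure_toNNReal_singleton (by positivity),
      poissonMeasure_toNNReal_singleton (by positivity), ← ENNReal.ofReal_mul
      (poissonMass_nonneg ht0.le _), ← ENNReal.ofReal_mul (by positivity),
      ← ENNReal.ofReal_mul (by positivity), poissonMass, poissonMass, p3, p4, mul_pow]
    congr 1
    field_simp

theorem lintegral_spikeSlabPrior_poissonLaw {n : ℕ} {h κ : ℝ} {r : Fin n → ℝ} (hh : 0 < h)
    (hκ : 0 < κ) (hr : ∀ i, 0 < r i) (x : Fin n → ℕ) :
    ∫⁻ θ, poissonLaw (fun i => r i * θ i) {x} ∂spikeSlabPrior n h κ =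
      ENNReal.ofReal (∏ i, marginalMass h κ (r i) (x i)) := by
  simp_rw [poissonLaw_singleton]
  rw [spikeSlabPrior, lintegral_pi_fin_prod _ (fun i t => poissonMeasure (r i * t).toNNReal {x i})
    fun i => measurable_poissonMeasure_singleton _ _]
  simp_rw [fun i => lintegral_spikeSlabCoord_marginal hh hκ (hr i) (x i)]
  rw [ENNReal.ofReal_prod_of_nonneg fun i _ => (marginalMass_pos hh hκ (hr i) (x i)).le]

/-- Prior and likelihoods are products, so Tonelli splits both integrals; this is what lets the loss
be bounded one coordinate at a time. -/
theorem bayesDensity_spikeSlab {n : ℕ} {h κ : ℝ} {r : Fin n → ℝ} (hh : 0 < h) (hκ : 0 < κ)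
    (hr : ∀ i, 0 < r i) (x y : Fin n → ℕ) :
    bayesDensity (spikeSlabPrior n h κ) r x y =
      ∏ i, ENNReal.ofReal (jointMass h κ (r i) (x i) (y i) / marginalMass h κ (r i) (x i)) := by
  have hm := fun k => measurable_poissonMeasure_singleton 1 k
  simp only [one_mul] at hm
  have h1 : ∫⁻ θ, poissonLaw θ {y} * poissonLaw (fun i => r i * θ i) {x} ∂spikeSlabPrior n h κ =
      ∏ i, ENNReal.ofReal (jointMass h κ (r i) (x i) (y i)) := by
    simp_rw [poissonLaw_singleton, ← Finset.prod_mul_distrib]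
    rw [spikeSlabPrior, lintegral_pi_fin_prod _ (fun i t => poissonMeasure t.toNNReal {y i} *
      poissonMeasure (r i * t).toNNReal {x i})
      fun i => (hm _).mul (measurable_poissonMeasure_singleton _ _)]
    simp_rw [fun i => lintegral_spikeSlabCoord_joint hh hκ (hr i) (x i) (y i)]
  have hA := fun i => marginalMass_pos hh hκ (hr i) (x i)
  have hB := fun i => jointMass_pos hh hκ (hr i) (x i) (y i)
  rw [bayesDensity, h1, lintegral_spikeSlabPrior_poissonLaw hh hκ hr,
    ← ENNReal.ofReal_prod_of_nonneg fun i _ => (hB i).le,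
    ← ENNReal.ofReal_prod_of_nonneg fun i _ => (div_pos (hB i) (hA i)).le,
    ← ENNReal.ofReal_div_of_pos (Finset.prod_pos fun i _ => hA i), Finset.prod_div_distrib]

theorem bayesPredictive_singleton {n : ℕ} (prior : Measure (Fin n → ℝ)) (r : Fin n → ℝ)
    (x y : Fin n → ℕ) : bayesPredictive prior r x {y} = bayesDensity prior r x y := by
  rw [bayesPredictive, withDensity_apply _ (measurableSet_singleton y), lintegral_singleton,
    Measure.count_singleton, mul_one]

theorem measurable_poissonLaw_singleton {n : ℕ} (r : Fin n → ℝ) (x : Fin n → ℕ) :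
    Measurable fun θ : Fin n → ℝ => poissonLaw (fun i => r i * θ i) {x} := by
  simp_rw [poissonLaw_singleton]
  exact Finset.measurable_fun_prod _ fun i _ =>
    (measurable_poissonMeasure_singleton (r i) (x i)).comp (measurable_pi_apply i)

/-- Summing the numerator over `y` under the integral returns the denominator, which is positive and
finite even though the prior is improper. -/
theorem isProbabilityMeasure_bayesPredictive {n : ℕ} {h κ : ℝ} {r : Fin n → ℝ} (hh : 0 < h)
    (hκ : 0 < κ) (hr : ∀ i, 0 < r i) (x : Fin n → ℕ) :
    IsProbabilityMeasure (bayesPredictive (spikeSlabPrior n h κ) r x) := by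
  constructor
  have hm := measurable_poissonLaw_singleton (fun _ : Fin n => (1 : ℝ))
  simp only [one_mul] at hm
  rw [bayesPredictive, withDensity_apply _ MeasurableSet.univ, setLIntegral_univ,
    lintegral_count]
  simp_rw [bayesDensity, div_eq_mul_inv]
  have hmul : ∀ y, AEMeasurable (fun θ : Fin n → ℝ =>
      poissonLaw θ {y} * poissonLaw (fun i => r i * θ i) {x}) (spikeSlabPrior n h κ) :=
    fun y => ((hm y).mul (measurable_poissonLaw_singleton r x)).aemeasurable
  rw [ENNReal.tsum_mul_right, ← lintegral_tsum hmul]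
  simp_rw [ENNReal.tsum_mul_right]
  have h3 : ∀ θ : Fin n → ℝ, ∑' y, poissonLaw θ {y} = 1 := fun θ => by
    have := Measure.tsum_indicator_apply_singleton (poissonLaw θ) univ MeasurableSet.univ
    simpa using this
  simp_rw [h3, one_mul]
  have hpos : 0 < ∏ i, marginalMass h κ (r i) (x i) :=
    Finset.prod_pos fun i _ => marginalMass_pos hh hκ (hr i) (x i)
  rw [lintegral_spikeSlabPrior_poissonLaw hh hκ hr]
  exact ENNReal.mul_inv_cancel (by simpa using hpos) (by simp)

theorem sHat_pos {n : ℕ} (x : Fin n → ℕ) : 0 < sHat x := by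
  unfold sHat; omega

theorem isProbabilityMeasure_adaptivePredictive {n : ℕ} (hn : 0 < n) {κ : ℝ} {r : Fin n → ℝ}
    (hκ : 0 < κ) (hr : ∀ i, 0 < r i) (x : Fin n → ℕ) :
    IsProbabilityMeasure (adaptivePredictive κ r x) := by
  have := sHat_pos x
  exact isProbabilityMeasure_bayesPredictive (by positivity) hκ hr x

theorem minimaxRisk_le_maxRisk_adaptive {n : ℕ} (hn : 0 < n) {κ : ℝ} {r : Fin n → ℝ}
    (hκ : 0 < κ) (hr : ∀ i, 0 < r i) (s : ℝ) :
    minimaxRisk r s ≤ maxRisk r s (adaptivePredictive κ r) := by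
  have := isProbabilityMeasure_adaptivePredictive hn hκ hr
  refine (iInf_le _ fun x => (adaptivePredictive κ r x).toPMF).trans_eq ?_
  simp only [Measure.toPMF_toMeasure]

/-! ### Poisson moments -/

theorem hasSum_poissonMass {m : ℝ} (hm : 0 ≤ m) : HasSum (poissonMass m) 1 := by
  have := hasSum_one_poissonMeasure m.toNNReal
  simp only [Real.coe_toNNReal _ hm] at this
  exact this

theorem integral_poisson_of_hasSum {m a : ℝ} (hm : 0 ≤ m) {f : ℕ → ℝ} (hf : ∀ k, 0 ≤ f k)
    (h : HasSum (fun k => poissonMass m k * f k) a) :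
    Integrable f (poissonMeasure m.toNNReal) ∧ ∫ k, f k ∂(poissonMeasure m.toNNReal) = a := by
  constructor
  · rw [integrable_poissonMeasure_iff]
    simp only [Real.coe_toNNReal _ hm, Real.norm_of_nonneg (hf _)]
    exact h.summable
  · rw [integral_poissonMeasure]
    simp only [Real.coe_toNNReal _ hm, smul_eq_mul]
    exact h.tsum_eq

theorem poisson_mean {m : ℝ} (hm : 0 ≤ m) :
    Integrable (fun k : ℕ => (k : ℝ)) (poissonMeasure m.toNNReal) ∧
      ∫ k : ℕ, (k : ℝ) ∂(poissonMeasure m.toNNReal) = m := by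
  refine integral_poisson_of_hasSum hm (fun k => k.cast_nonneg) ?_
  rw [← hasSum_nat_add_iff' 1]
  simp only [Finset.range_one, Finset.sum_singleton, Nat.cast_zero, mul_zero, sub_zero]
  have e : (fun k : ℕ => poissonMass m (k + 1) * ((k + 1 : ℕ) : ℝ)) =
      fun k => m * poissonMass m k := by
    funext k
    rw [poissonMass, poissonMass, Nat.factorial_succ]
    push_cast
    field_simp
    ring
  rw [e]
  simpa using (hasSum_poissonMass hm).mul_left m

/-- The factor `m / (k + 1)` shifts the Poisson mass from `k` to `k + 1`, so the total is the mass
of the positive integers. -/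
theorem poisson_inverse_moment {m : ℝ} (hm : 0 ≤ m) :
    Integrable (fun k : ℕ => m / (k + 1)) (poissonMeasure m.toNNReal) ∧
      ∫ k : ℕ, m / (k + 1) ∂(poissonMeasure m.toNNReal) = 1 - Real.exp (-m) := by
  refine integral_poisson_of_hasSum hm (fun k => by positivity) ?_
  have h := (hasSum_nat_add_iff' 1).2 (hasSum_poissonMass hm)
  have e : (fun k : ℕ => poissonMass m k * (m / (k + 1))) = fun k => poissonMass m (k + 1) := by
    funext k
    rw [poissonMass, poissonMass, Nat.factorial_succ]
    push_cast
    field_simp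
    ring
  rw [e]
  simpa [poissonMass] using h

theorem poisson_zero_indicator {m : ℝ} (hm : 0 ≤ m) :
    Integrable (fun k : ℕ => if k = 0 then (1 : ℝ) else 0) (poissonMeasure m.toNNReal) ∧
      ∫ k : ℕ, (if k = 0 then (1 : ℝ) else 0) ∂(poissonMeasure m.toNNReal) = Real.exp (-m) := by
  refine integral_poisson_of_hasSum hm (fun k => by split_ifs <;> norm_num) ?_
  have := hasSum_ite_eq (0 : ℕ) (Real.exp (-m))
  convert this using 2 with k
  by_cases hk : k = 0 <;> simp [hk, poissonMass]

theorem integrable_eval_poissonLaw {n : ℕ} {m : Fin n → ℝ} {i : Fin n} {f : ℕ → ℝ}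
    (hf : Integrable f (poissonMeasure (m i).toNNReal)) :
    Integrable (fun x : Fin n → ℕ => f (x i)) (poissonLaw m) :=
  (measurePreserving_eval_poissonLaw m i).integrable_comp_of_integrable hf

theorem integral_eval_poissonLaw {n : ℕ} (m : Fin n → ℝ) (i : Fin n) (f : ℕ → ℝ) :
    ∫ x, f (x i) ∂(poissonLaw m) = ∫ k, f k ∂(poissonMeasure (m i).toNNReal) := by
  have h := measurePreserving_eval_poissonLaw m i
  rw [← h.map_eq, integral_map h.measurable.aemeasurable
    (measurable_of_countable f).aestronglyMeasurable]

theorem lintegral_eval_poissonLaw {n : ℕ} (m : Fin n → ℝ) (i : Fin n) (f : ℕ → ℝ≥0∞) :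
    ∫⁻ x, f (x i) ∂(poissonLaw m) = ∫⁻ k, f k ∂(poissonMeasure (m i).toNNReal) :=
  (measurePreserving_eval_poissonLaw m i).lintegral_comp (measurable_of_countable f)

/-! ### Logarithmic loss of one coordinate -/

/-- The mean of the Gamma posterior of a coordinate at `x ≥ 1`, shifted down by `1 / r`. -/
def posteriorMean (κ r : ℝ) (x : ℕ) : ℝ := (x + κ - 1) / r

/-- An upper bound for the logarithmic loss of one coordinate. -/
def logLossBound (h κ K r θ : ℝ) (x y : ℕ) : ℝ :=
  if x = 0 then
    h * K + (1 - if y = 0 then (1 : ℝ) else 0) *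
      (Real.log (1 / h) + (2 * (r + 1) * θ + Real.log (2 / min θ 1)))
  else (θ / posteriorMean κ r x - 1) * y + ((x + κ) / r - θ)

/-- The expectation of `logLossBound` over the future observation. -/
def coordLoss (h κ K r θ : ℝ) (x : ℕ) : ℝ :=
  if x = 0 then
    h * K + (1 - Real.exp (-θ)) *
      (Real.log (1 / h) + (2 * (r + 1) * θ + Real.log (2 / min θ 1)))
  else (θ - posteriorMean κ r x) ^ 2 / posteriorMean κ r x + 1 / r

theorem posteriorMean_pos {κ r : ℝ} {x : ℕ} (hκ : 0 < κ) (hr : 0 < r) (hx : x ≠ 0) :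
    0 < posteriorMean κ r x := by
  have : (1 : ℝ) ≤ x := by exact_mod_cast Nat.one_le_iff_ne_zero.2 hx
  unfold posteriorMean
  exact div_pos (by linarith) hr

theorem integral_logLossBound {h κ K r θ : ℝ} {x : ℕ} (hκ : 0 < κ) (hr : 0 < r) (hθ : 0 ≤ θ) :
    Integrable (logLossBound h κ K r θ x) (poissonMeasure θ.toNNReal) ∧
      ∫ y, logLossBound h κ K r θ x y ∂(poissonMeasure θ.toNNReal) = coordLoss h κ K r θ x := by
  unfold logLossBound coordLoss
  by_cases hx : x = 0
  · simp only [hx, if_true]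
    obtain ⟨h1, h2⟩ := poisson_zero_indicator hθ
    have h3 : Integrable (fun y : ℕ => ((1 : ℝ) - if y = 0 then (1 : ℝ) else 0) *
        (Real.log (1 / h) + (2 * (r + 1) * θ + Real.log (2 / min θ 1))))
        (poissonMeasure θ.toNNReal) := ((integrable_const (1 : ℝ)).sub h1).mul_const
      (Real.log (1 / h) + (2 * (r + 1) * θ + Real.log (2 / min θ 1)))
    refine ⟨(integrable_const (h * K)).add h3, ?_⟩
    have h4 : ∫ y : ℕ, ((1 : ℝ) - if y = 0 then (1 : ℝ) else 0) ∂(poissonMeasure θ.toNNReal) =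
        1 - Real.exp (-θ) := by
      rw [integral_sub (integrable_const 1) h1, h2]; simp
    rw [integral_add (integrable_const (h * K)) h3,
      integral_mul_const _ (fun y : ℕ => (1 : ℝ) - if y = 0 then (1 : ℝ) else 0), h4]
    simp
  · simp only [hx, if_false]
    obtain ⟨h1, h2⟩ := poisson_mean hθ
    have h3 := h1.const_mul (θ / posteriorMean κ r x - 1)
    refine ⟨h3.add (integrable_const _), ?_⟩
    rw [integral_add h3 (integrable_const _), integral_const_mul, h2]
    have hm := posteriorMean_pos hκ hr hx
    -- With `m = posteriorMean κ r x`, this completes the square: `(θ/m - 1) θ + m - θ = (θ - m)² /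
    -- m`, leaving `1 / r`.
    have hc : (x + κ) / r = posteriorMean κ r x + 1 / r := by
      unfold posteriorMean; field_simp; ring
    simp only [integral_const, probReal_univ, one_smul]
    rw [hc]
    field_simp
    ring

/-- At `x = 0` the marginal mass is at most `e^{hK}`. The spike alone then handles `y = 0`, while `y
> 0` relies on the slab near `θ` (`gammaInt_ge_window`) and pays `log(1/h)`. At `x ≥ 1` the spike is
excluded and `h` cancels in the quotient, so Jensen (`gammaInt_shift_ge`) suffices. -/
theorem poissonMass_mul_exp_le {h κ r r₀ θ : ℝ} (hh : 0 < h) (hκ : κ ∈ Ioc (0 : ℝ) 1)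
    (hr₀ : 0 < r₀) (hr : r₀ ≤ r) (hθ : 0 ≤ θ) (x y : ℕ) :
    Real.exp (-logLossBound h κ (gammaInt κ r₀) r θ x y) * poissonMass θ y ≤
      jointMass h κ r x y / marginalMass h κ r x := by
  have hκ0 := hκ.1
  have hr0 : 0 < r := hr₀.trans_le hr
  have hM := marginalMass_pos hh hκ0 hr0 x
  rw [le_div_iff₀ hM]
  unfold logLossBound
  by_cases hx : x = 0
  · subst hx
    simp only [if_true]
    have hM1 : marginalMass h κ r 0 ≤ Real.exp (h * gammaInt κ r₀) := by
      have h1 : marginalMass h κ r 0 = 1 + h * gammaInt κ r := by simp [marginalMass]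
      have h2 := gammaInt_anti hκ0 hr₀ hr
      have h3 := Real.add_one_le_exp (h * gammaInt κ r₀)
      rw [h1]; nlinarith
    suffices H : Real.exp (-((1 - if y = 0 then (1 : ℝ) else 0) *
        (Real.log (1 / h) + (2 * (r + 1) * θ + Real.log (2 / min θ 1))))) * poissonMass θ y ≤
        jointMass h κ r 0 y by
      refine le_trans ?_ H
      set E := (1 - if y = 0 then (1 : ℝ) else 0) *
        (Real.log (1 / h) + (2 * (r + 1) * θ + Real.log (2 / min θ 1)))
      have hp := poissonMass_nonneg hθ y
      calc Real.exp (-(h * gammaInt κ r₀ + E)) * poissonMass θ y * marginalMass h κ r 0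
          ≤ Real.exp (-(h * gammaInt κ r₀ + E)) * poissonMass θ y *
              Real.exp (h * gammaInt κ r₀) := by gcongr
        _ = (Real.exp (-(h * gammaInt κ r₀ + E)) * Real.exp (h * gammaInt κ r₀)) *
              poissonMass θ y := by ring
        _ = _ := by rw [← Real.exp_add]; ring_nf
    by_cases hy : y = 0
    · subst hy
      have hg := gammaInt_pos hκ0 (show 0 < r + 1 by linarith)
      have h1 : jointMass h κ r 0 0 = 1 + h * gammaInt κ (r + 1) := by simp [jointMass]
      have h2 : Real.exp (-θ) ≤ 1 := by simpa using hθ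
      have h3 := mul_pos hh hg
      simp only [if_true, sub_self, zero_mul, neg_zero, Real.exp_zero, one_mul]
      rw [h1]
      simp only [poissonMass, pow_zero, mul_one, Nat.factorial_zero, Nat.cast_one, div_one]
      linarith
    · simp only [hy, if_false, sub_zero, one_mul]
      have h1 : jointMass h κ r 0 y = h / y ! * gammaInt (κ + y) (r + 1) := by
        simp [jointMass, hy]
      rcases hθ.eq_or_lt with h0 | h0
      · have hj := jointMass_pos hh hκ0 hr0 0 y
        rw [← h0]
        simp only [poissonMass, zero_pow hy, mul_zero, zero_div]
        exact hj.le
      · have h2 := gammaInt_ge_window hκ (show 0 < r + 1 by linarith) h0 y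
        have hmin : 0 < min θ 1 := lt_min h0 one_pos
        rw [h1, neg_add, neg_add, Real.exp_add, Real.exp_add, ← Real.log_inv, ← Real.log_inv,
          Real.exp_log (by positivity), Real.exp_log (by positivity)]
        have h3 : Real.exp (-θ) ≤ 1 := by simpa using hθ
        calc (1 / h)⁻¹ * (Real.exp (-(2 * (r + 1) * θ)) * (2 / min θ 1)⁻¹) * poissonMass θ y
            = Real.exp (-θ) * (h / y ! *
                (θ ^ y * Real.exp (-(2 * (r + 1) * θ)) * (min θ 1 / 2))) := by
              rw [poissonMass]; field_simp
          _ ≤ 1 * (h / y ! * gammaInt (κ + y) (r + 1)) := by gcongr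
          _ = _ := one_mul _
  · simp only [hx, if_false]
    have hx1 : (1 : ℝ) ≤ x := by exact_mod_cast Nat.one_le_iff_ne_zero.2 hx
    have hm := posteriorMean_pos hκ0 hr0 hx
    have h1 := gammaInt_shift_ge (a := x + κ) (by linarith) hr0 y
    have e1 : marginalMass h κ r x = h * r ^ x / x ! * gammaInt (x + κ) r := by
      simp [marginalMass, hx]
    have e2 : jointMass h κ r x y = h * r ^ x / (x ! * y !) * gammaInt (x + κ + y) (r + 1) := by
      simp [jointMass, hx]
    rw [e1, e2]
    change posteriorMean κ r x ^ y * _ * _ ≤ _ at h1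
    set m := posteriorMean κ r x
    set c := (x + κ) / r
    have hg := gammaInt_pos (a := x + κ) (by positivity) hr0
    -- The inequality `log (θ / m) ≤ θ / m - 1`, exponentiated and raised to the power `y`.
    have h2 : Real.exp (-((θ / m - 1) * y)) * θ ^ y ≤ m ^ y := by
      have h3 : Real.exp (-(θ / m - 1)) * θ ≤ m := by
        have h4 := Real.add_one_le_exp (θ / m - 1)
        rw [Real.exp_neg, inv_mul_le_iff₀ (Real.exp_pos _)]
        have h5 : θ / m ≤ Real.exp (θ / m - 1) := by linarith
        rwa [div_le_iff₀ hm] at h5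
      have h6 : -((θ / m - 1) * (y : ℝ)) = y * (-(θ / m - 1)) := by ring
      rw [h6, Real.exp_nat_mul, ← mul_pow]
      exact pow_le_pow_left₀ (by positivity) h3 y
    have h7 : Real.exp (-((θ / m - 1) * y + (c - θ))) * Real.exp (-θ) =
        Real.exp (-((θ / m - 1) * y)) * Real.exp (-c) := by
      rw [← Real.exp_add, ← Real.exp_add]; ring_nf
    calc Real.exp (-((θ / m - 1) * y + (c - θ))) * poissonMass θ y *
          (h * r ^ x / x ! * gammaInt (x + κ) r)
        = (Real.exp (-((θ / m - 1) * y + (c - θ))) * Real.exp (-θ)) * θ ^ y *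
            (h * r ^ x / (x ! * y !) * gammaInt (x + κ) r) := by
          rw [poissonMass]; field_simp
      _ = (Real.exp (-((θ / m - 1) * y)) * θ ^ y) * Real.exp (-c) *
            (h * r ^ x / (x ! * y !) * gammaInt (x + κ) r) := by rw [h7]; ring
      _ ≤ m ^ y * Real.exp (-c) * (h * r ^ x / (x ! * y !) * gammaInt (x + κ) r) := by gcongr
      _ = h * r ^ x / (x ! * y !) * (m ^ y * Real.exp (-c) * gammaInt (x + κ) r) := by ring
      _ ≤ _ := by gcongr

/-- Given `x`, the plug-in value of `h` is a constant, so the predictive law is a product and the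
coordinate bounds multiply. -/
theorem klDiv_adaptivePredictive_le {n : ℕ} (hn : 0 < n) {κ r₀ : ℝ} {r θ : Fin n → ℝ}
    (hκ : κ ∈ Ioc (0 : ℝ) 1) (hr₀ : 0 < r₀) (hr : ∀ i, r₀ ≤ r i) (hθ : ∀ i, 0 ≤ θ i)
    (x : Fin n → ℕ) :
    InformationTheory.klDiv (poissonLaw θ) (adaptivePredictive κ r x) ≤
      ENNReal.ofReal (∑ i, coordLoss ((sHat x : ℝ) / n) κ (gammaInt κ r₀) (r i) (θ i) (x i)) := by
  have hr0 : ∀ i, 0 < r i := fun i => hr₀.trans_le (hr i)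
  have := isProbabilityMeasure_adaptivePredictive hn hκ.1 hr0 x
  have hs := sHat_pos x
  have hh : 0 < (sHat x : ℝ) / n := by positivity
  set h := (sHat x : ℝ) / n
  have hI := fun i => integral_logLossBound (h := h) (K := gammaInt κ r₀) (x := x i)
    hκ.1 (hr0 i) (hθ i)
  have hint : ∀ i, Integrable
      (fun y : Fin n → ℕ => logLossBound h κ (gammaInt κ r₀) (r i) (θ i) (x i) (y i))
      (poissonLaw θ) := fun i => integrable_eval_poissonLaw (hI i).1
  have hval : ∑ i, coordLoss h κ (gammaInt κ r₀) (r i) (θ i) (x i) =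
      ∫ y, ∑ i, logLossBound h κ (gammaInt κ r₀) (r i) (θ i) (x i) (y i) ∂(poissonLaw θ) := by
    rw [integral_finsetSum _ fun i _ => hint i]
    exact Finset.sum_congr rfl fun i _ => by rw [integral_eval_poissonLaw θ i, (hI i).2]
  rw [hval]
  refine klDiv_le_ofReal_integral _ _ _ (integrable_finsetSum _ fun i _ => hint i) fun y => ?_
  rw [adaptivePredictive, bayesPredictive_singleton, bayesDensity_spikeSlab hh hκ.1 hr0,
    poissonLaw_singleton, ← Finset.sum_neg_distrib, Real.exp_sum,
    ENNReal.ofReal_prod_of_nonneg fun i _ => (Real.exp_pos _).le, ← Finset.prod_mul_distrib]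
  refine Finset.prod_le_prod' fun i _ => ?_
  rw [poissonMeasure_toNNReal_singleton (hθ i), ← ENNReal.ofReal_mul (Real.exp_pos _).le]
  exact ENNReal.ofReal_le_ofReal (poissonMass_mul_exp_le hh hκ hr₀ (hr i) (hθ i) _ _)

/-! ### Mean loss at a signal -/

/-- An upper bound for the loss at a coordinate carrying a signal, with the logarithm of the
inverse sparsity replaced by `ℓ`. -/
def signalLoss (κ r θ ℓ : ℝ) (x : ℕ) : ℝ :=
  if x = 0 then (1 - Real.exp (-θ)) * (ℓ + (2 * (r + 1) * θ + Real.log (2 / min θ 1)))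
  else (θ - posteriorMean κ r x) ^ 2 / posteriorMean κ r x + 1 / r

theorem log_two_div_min_nonneg {θ : ℝ} (hθ : 0 < θ) : 0 ≤ Real.log (2 / min θ 1) := by
  have hmin : 0 < min θ 1 := lt_min hθ one_pos
  refine Real.log_nonneg ?_
  rw [le_div_iff₀ hmin]
  linarith [min_le_right θ 1]

theorem one_sub_exp_neg_nonneg {θ : ℝ} (hθ : 0 ≤ θ) : 0 ≤ 1 - Real.exp (-θ) := by
  have : Real.exp (-θ) ≤ 1 := by simpa using hθ
  linarith

theorem signalLoss_nonneg {κ r θ ℓ : ℝ} (hκ : 0 < κ) (hr : 0 < r) (hθ : 0 < θ) (hℓ : 0 ≤ ℓ)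
    (x : ℕ) : 0 ≤ signalLoss κ r θ ℓ x := by
  unfold signalLoss
  split_ifs with hx
  · have := one_sub_exp_neg_nonneg hθ.le
    have := log_two_div_min_nonneg hθ
    positivity
  · have := posteriorMean_pos hκ hr hx
    positivity

theorem mul_exp_neg_le_one (u : ℝ) : u * Real.exp (-u) ≤ 1 := by
  have h := Real.add_one_le_exp u
  rw [Real.exp_neg, ← div_eq_mul_inv, div_le_one (Real.exp_pos _)]
  linarith

/-- The factor `exp (-(r * θ))` is the chance of a zero count. Only the `ℓ` term grows with the
sparsity. The terms linear in `θ` are tamed by `u e^{-u} ≤ 1`, and the logarithm, singular at small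
`θ`, by `1 - e^{-θ} ≤ min θ 1`. -/
theorem exp_mul_silent_loss_le {r r₀ θ ℓ C : ℝ} (hr₀ : 0 < r₀) (hr : r₀ ≤ r) (hθ : 0 < θ)
    (hℓ : 0 ≤ ℓ) (hC : ∀ t : ℝ, 0 ≤ t → Real.exp (-(r₀ * t)) * (1 - Real.exp (-t)) ≤ C) :
    Real.exp (-(r * θ)) *
      ((1 - Real.exp (-θ)) * (ℓ + (2 * (r + 1) * θ + Real.log (2 / min θ 1)))) ≤
      C * ℓ + (4 + 2 / r₀) := by
  have hmin : 0 < min θ 1 := lt_min hθ one_pos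
  have hb := one_sub_exp_neg_nonneg hθ.le
  have hb1 : 1 - Real.exp (-θ) ≤ min θ 1 := by
    refine le_min ?_ ?_
    · linarith [Real.add_one_le_exp (-θ)]
    · linarith [Real.exp_pos (-θ)]
  have hlog := log_two_div_min_nonneg hθ
  have hlog2 : Real.log (2 / min θ 1) ≤ 2 / min θ 1 :=
    (Real.log_le_sub_one_of_pos (by positivity)).trans (by linarith)
  have hr0 : 0 < r := hr₀.trans_le hr
  have hexp : Real.exp (-(r * θ)) ≤ Real.exp (-(r₀ * θ)) := by gcongr
  have hexp1 : Real.exp (-(r * θ)) ≤ 1 := by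
    rw [Real.exp_le_one_iff]; have := mul_pos hr0 hθ; linarith
  have hb2 : 1 - Real.exp (-θ) ≤ 1 := hb1.trans (min_le_right _ _)
  have t1 : Real.exp (-(r * θ)) * (1 - Real.exp (-θ)) * ℓ ≤ C * ℓ := by
    gcongr
    exact (mul_le_mul_of_nonneg_right hexp hb).trans (hC θ hθ.le)
  have t2 : Real.exp (-(r * θ)) * (1 - Real.exp (-θ)) * (2 * (r * θ)) ≤ 2 := by
    calc Real.exp (-(r * θ)) * (1 - Real.exp (-θ)) * (2 * (r * θ))
        ≤ Real.exp (-(r * θ)) * 1 * (2 * (r * θ)) := by gcongr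
      _ = 2 * (r * θ * Real.exp (-(r * θ))) := by ring
      _ ≤ 2 := by linarith [mul_exp_neg_le_one (r * θ)]
  have t3 : Real.exp (-(r * θ)) * (1 - Real.exp (-θ)) * (2 * θ) ≤ 2 / r₀ := by
    calc Real.exp (-(r * θ)) * (1 - Real.exp (-θ)) * (2 * θ)
        ≤ Real.exp (-(r₀ * θ)) * 1 * (2 * θ) := by gcongr
      _ = 2 / r₀ * (r₀ * θ * Real.exp (-(r₀ * θ))) := by field_simp
      _ ≤ 2 / r₀ * 1 := by gcongr; exact mul_exp_neg_le_one _
      _ = _ := mul_one _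
  have t4 : Real.exp (-(r * θ)) * (1 - Real.exp (-θ)) * Real.log (2 / min θ 1) ≤ 2 := by
    calc Real.exp (-(r * θ)) * (1 - Real.exp (-θ)) * Real.log (2 / min θ 1)
        ≤ 1 * min θ 1 * (2 / min θ 1) := by gcongr
      _ = 2 := by field_simp
  calc _ = Real.exp (-(r * θ)) * (1 - Real.exp (-θ)) * ℓ +
        Real.exp (-(r * θ)) * (1 - Real.exp (-θ)) * (2 * (r * θ)) +
        Real.exp (-(r * θ)) * (1 - Real.exp (-θ)) * (2 * θ) +
        Real.exp (-(r * θ)) * (1 - Real.exp (-θ)) * Real.log (2 / min θ 1) := by ring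
    _ ≤ C * ℓ + 2 + 2 / r₀ + 2 := by gcongr
    _ = _ := by ring

/-- Replaces `x + κ - 1` by `x + 1`, whose inverse has an exact Poisson mean: `κ (x + 1) / 2 ≤ x + κ
- 1` for `x ≥ 1`, and the shift `2 - κ ≤ 2` in the numerator costs the factor 2 and the constant 4.
-/
theorem sq_sub_posteriorMean_div_le {κ r θ : ℝ} (hκ : κ ∈ Ioc (0 : ℝ) 1) (hr : 0 < r) {x : ℕ}
    (hx : x ≠ 0) :
    (θ - posteriorMean κ r x) ^ 2 / posteriorMean κ r x ≤
      4 / (κ * r) * (r * θ * (r * θ / (x + 1)) - 2 * (r * θ) + (x + 1) + 4) := by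
  have hx1 : (1 : ℝ) ≤ x := by exact_mod_cast Nat.one_le_iff_ne_zero.2 hx
  have hκ0 := hκ.1
  have hκ1 := hκ.2
  set μ := r * θ with hμ
  have hD : 0 < (x : ℝ) + κ - 1 := by linarith
  have e1 : (θ - posteriorMean κ r x) ^ 2 / posteriorMean κ r x =
      1 / r * ((μ - (x + κ - 1)) ^ 2 / (x + κ - 1)) := by
    rw [hμ, posteriorMean]; field_simp
  have h1 : κ * (x + 1) / 2 ≤ x + κ - 1 := by nlinarith
  have h2 : (μ - (x + κ - 1)) ^ 2 ≤ 2 * ((μ - (x + 1)) ^ 2 + 4) := by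
    have : (2 - κ) ^ 2 ≤ 4 := by nlinarith
    nlinarith [sq_nonneg (μ - (x + 1) - (2 - κ))]
  rw [e1]
  calc 1 / r * ((μ - (x + κ - 1)) ^ 2 / (x + κ - 1))
      ≤ 1 / r * (2 * ((μ - (x + 1)) ^ 2 + 4) / (κ * (x + 1) / 2)) := by gcongr
    _ = 4 / (κ * r) * ((μ - (x + 1)) ^ 2 / (x + 1) + 4 / (x + 1)) := by field_simp; ring
    _ ≤ 4 / (κ * r) * ((μ - (x + 1)) ^ 2 / (x + 1) + 4) := by
        gcongr
        rw [div_le_iff₀ (by positivity)]; linarith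
    _ = _ := by field_simp; ring

theorem lintegral_signalLoss_le {κ r r₀ θ ℓ C : ℝ} (hκ : κ ∈ Ioc (0 : ℝ) 1) (hr₀ : 0 < r₀)
    (hr : r₀ ≤ r) (hθ : 0 < θ) (hℓ : 0 ≤ ℓ)
    (hC : ∀ t : ℝ, 0 ≤ t → Real.exp (-(r₀ * t)) * (1 - Real.exp (-t)) ≤ C) :
    ∫⁻ x, ENNReal.ofReal (signalLoss κ r θ ℓ x) ∂(poissonMeasure (r * θ).toNNReal) ≤
      ENNReal.ofReal (C * ℓ + (4 + 3 / r₀ + 20 / (κ * r₀))) := by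
  have hκ0 := hκ.1
  have hr0 : 0 < r := hr₀.trans_le hr
  set μ := r * θ with hμ
  have hμ0 : 0 < μ := by positivity
  set E := (1 - Real.exp (-θ)) * (ℓ + (2 * (r + 1) * θ + Real.log (2 / min θ 1))) with hE
  have hE0 : 0 ≤ E := by
    have := one_sub_exp_neg_nonneg hθ.le
    have := log_two_div_min_nonneg hθ
    positivity
  obtain ⟨i1, v1⟩ := poisson_zero_indicator hμ0.le
  obtain ⟨i2, v2⟩ := poisson_inverse_moment hμ0.le
  obtain ⟨i3, v3⟩ := poisson_mean hμ0.le
  set F : ℕ → ℝ := fun x => E * (if x = 0 then (1 : ℝ) else 0) +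
    (4 / (κ * r) * (μ * (μ / (x + 1)) + x) + (4 / (κ * r) * (5 - 2 * μ) + 1 / r)) with hF
  have j2 : Integrable (fun x : ℕ => 4 / (κ * r) * (μ * (μ / (x + 1)) + x))
      (poissonMeasure μ.toNNReal) := ((i2.const_mul μ).add i3).const_mul _
  have j3 : Integrable (fun x : ℕ => 4 / (κ * r) * (μ * (μ / (x + 1)) + x) +
      (4 / (κ * r) * (5 - 2 * μ) + 1 / r)) (poissonMeasure μ.toNNReal) :=
    j2.add (integrable_const _)
  have hFint : Integrable F (poissonMeasure μ.toNNReal) := (i1.const_mul E).add j3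
  have hFval : ∫ x, F x ∂(poissonMeasure μ.toNNReal) = E * Real.exp (-μ) +
      (4 / (κ * r) * (μ * (1 - Real.exp (-μ)) + μ) + (4 / (κ * r) * (5 - 2 * μ) + 1 / r)) := by
    rw [hF, integral_add (i1.const_mul E) j3, integral_const_mul, v1,
      integral_add j2 (integrable_const _), integral_const_mul, integral_add (i2.const_mul μ) i3,
      integral_const_mul, v2, v3]
    simp
  -- Nonnegativity allows the quadratic term to be kept at `x = 0` as well, so that full Poisson
  -- moments apply.
  have hq : ∀ x : ℕ, 0 ≤ 4 / (κ * r) * (μ * (μ / (x + 1)) - 2 * μ + (x + 1) + 4) := fun x => by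
    have : μ * (μ / (x + 1)) - 2 * μ + (x + 1) + 4 = (μ - (x + 1)) ^ 2 / (x + 1) + 4 := by
      field_simp; ring
    rw [this]; positivity
  have hle : ∀ x, signalLoss κ r θ ℓ x ≤ F x := fun x => by
    have e : F x = E * (if x = 0 then (1 : ℝ) else 0) +
        4 / (κ * r) * (μ * (μ / (x + 1)) - 2 * μ + (x + 1) + 4) + 1 / r := by
      rw [hF]; ring
    have hr1 : 0 < 1 / r := by positivity
    rw [e, signalLoss]
    by_cases hx : x = 0
    · have := hq x
      simp only [hx, if_true] at this ⊢
      linarith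
    · simp only [hx, if_false, mul_zero, zero_add]
      have := sq_sub_posteriorMean_div_le (θ := θ) hκ hr0 hx
      linarith
  calc ∫⁻ x, ENNReal.ofReal (signalLoss κ r θ ℓ x) ∂(poissonMeasure μ.toNNReal)
      ≤ ∫⁻ x, ENNReal.ofReal (F x) ∂(poissonMeasure μ.toNNReal) :=
        lintegral_mono fun x => ENNReal.ofReal_le_ofReal (hle x)
    _ = ENNReal.ofReal (∫ x, F x ∂(poissonMeasure μ.toNNReal)) :=
        (ofReal_integral_eq_lintegral_ofReal hFint (ae_of_all _ fun x =>
          (signalLoss_nonneg hκ0 hr0 hθ hℓ x).trans (hle x))).symm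
    _ ≤ _ := by
        refine ENNReal.ofReal_le_ofReal ?_
        rw [hFval]
        have h1 := exp_mul_silent_loss_le hr₀ hr hθ hℓ hC
        have h2 : 1 / r ≤ 1 / r₀ := by gcongr
        have h3 : 20 / (κ * r) ≤ 20 / (κ * r₀) := by gcongr
        -- The terms linear in `μ` cancel, which makes the bound uniform in the size of the signal.
        have h4 : 4 / (κ * r) * (μ * (1 - Real.exp (-μ)) + μ) + 4 / (κ * r) * (5 - 2 * μ) ≤
            20 / (κ * r) := by
          have e : 4 / (κ * r) * (μ * (1 - Real.exp (-μ)) + μ) + 4 / (κ * r) * (5 - 2 * μ) =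
            20 / (κ * r) - 4 / (κ * r) * (μ * Real.exp (-μ)) := by ring
          rw [e]
          have : 0 ≤ 4 / (κ * r) * (μ * Real.exp (-μ)) := by positivity
          linarith
        have h5 : 3 / r₀ = 2 / r₀ + 1 / r₀ := by ring
        rw [h5]
        rw [mul_comm] at h1
        linarith

/-! ### The estimated sparsity is rarely too small -/

theorem lintegral_exp_neg_indicator_le {m : ℝ} (hm : 0 ≤ m) :
    ∫⁻ k, ENNReal.ofReal (if k = 0 then 1 else Real.exp (-1)) ∂(poissonMeasure m.toNNReal) ≤
      ENNReal.ofReal (Real.exp (-((1 - Real.exp (-m)) / 2))) := by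
  obtain ⟨i1, v1⟩ := poisson_zero_indicator hm
  have e : (fun k : ℕ => if k = 0 then 1 else Real.exp (-1)) =
      fun k => Real.exp (-1) + (1 - Real.exp (-1)) * (if k = 0 then (1 : ℝ) else 0) := by
    funext k; split_ifs <;> ring
  have hint : Integrable (fun k : ℕ => if k = 0 then 1 else Real.exp (-1))
      (poissonMeasure m.toNNReal) := by
    rw [e]; exact (integrable_const _).add (i1.const_mul _)
  rw [← ofReal_integral_eq_lintegral_ofReal hint
    (ae_of_all _ fun k => by dsimp only; split_ifs <;> positivity)]
  refine ENNReal.ofReal_le_ofReal ?_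
  rw [e, integral_add (integrable_const _) (i1.const_mul _), integral_const_mul, v1]
  simp only [integral_const, probReal_univ, one_smul]
  have h1 : Real.exp (-1) ≤ 1 / 2 := by
    rw [Real.exp_neg, one_div]
    exact inv_anti₀ (by norm_num) (by linarith [Real.add_one_le_exp (1 : ℝ)])
  have h2 := one_sub_exp_neg_nonneg hm
  have h3 := Real.add_one_le_exp (-((1 - Real.exp (-m)) / 2))
  nlinarith

/-- The product is `e^{-N}`, with `N` the number of positive counts. If `N ≥ μ/4` the quotient is at
most 4; otherwise it is at most `μ`, since `sHat x ≥ 1`, and `e^{μ/4 - N} ≥ 1`. -/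
theorem div_sHat_le {n : ℕ} {μ : ℝ} (hμ : 0 ≤ μ) (x : Fin n → ℕ) :
    μ / sHat x ≤ 4 + μ * Real.exp (μ / 4) * ∏ i, (if x i = 0 then 1 else Real.exp (-1)) := by
  set N := (Finset.univ.filter fun i => 1 ≤ x i).card with hN
  have hprod : ∏ i, (if x i = 0 then 1 else Real.exp (-1)) = Real.exp (-(N : ℝ)) := by
    have : ∀ i, (if x i = 0 then 1 else Real.exp (-1)) =
        if 1 ≤ x i then Real.exp (-1) else 1 := fun i => by
      by_cases h : x i = 0
      · simp [h]
      · simp [h, Nat.one_le_iff_ne_zero]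
    rw [Finset.prod_congr rfl fun i _ => this i, ← Finset.prod_filter, Finset.prod_const,
      ← Real.exp_nat_mul, ← hN]
    ring_nf
  rw [hprod]
  have hs1 : (1 : ℝ) ≤ sHat x := by exact_mod_cast sHat_pos x
  have hsN : (N : ℝ) ≤ sHat x := by exact_mod_cast le_max_right 1 N
  rw [div_le_iff₀ (by linarith)]
  rcases le_total (μ / 4) N with h | h
  · have : 0 ≤ μ * Real.exp (μ / 4) * Real.exp (-(N : ℝ)) := by positivity
    nlinarith
  · have h1 : 1 ≤ Real.exp (μ / 4) * Real.exp (-(N : ℝ)) := by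
      rw [← Real.exp_add]; exact Real.one_le_exp (by linarith)
    have h2 : μ ≤ μ * Real.exp (μ / 4) * Real.exp (-(N : ℝ)) := by nlinarith
    nlinarith

/-- A Chernoff bound: the numerator `μ` is the mean of `N`, and `e^{-N}` has mean at most
`e^{-μ/2}`, so the integral is at most `4 + μ e^{-μ/4} ≤ 8`. -/
theorem lintegral_div_sHat_le {n : ℕ} {m : Fin n → ℝ} (hm : ∀ i, 0 ≤ m i) :
    ∫⁻ x, ENNReal.ofReal ((∑ i, (1 - Real.exp (-m i))) / sHat x) ∂(poissonLaw m) ≤ 8 := by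
  set μ := ∑ i, (1 - Real.exp (-m i)) with hμ
  have hμ0 : 0 ≤ μ := Finset.sum_nonneg fun i _ => one_sub_exp_neg_nonneg (hm i)
  have hnn : ∀ k : ℕ, 0 ≤ (if k = 0 then 1 else Real.exp (-1)) := fun k => by
    split_ifs <;> positivity
  have h1 : ∀ x : Fin n → ℕ, ENNReal.ofReal (μ / sHat x) ≤ 4 + ENNReal.ofReal
      (μ * Real.exp (μ / 4)) * ∏ i, ENNReal.ofReal (if x i = 0 then 1 else Real.exp (-1)) :=
    fun x => by
      refine (ENNReal.ofReal_le_ofReal (div_sHat_le hμ0 x)).trans ?_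
      rw [ENNReal.ofReal_add (by norm_num)
        (mul_nonneg (by positivity) (Finset.prod_nonneg fun i _ => hnn _)),
        ENNReal.ofReal_mul (by positivity), ENNReal.ofReal_prod_of_nonneg fun i _ => hnn _]
      simp
  have h2 : ∫⁻ x, ∏ i, ENNReal.ofReal (if x i = 0 then 1 else Real.exp (-1)) ∂(poissonLaw m) ≤
      ENNReal.ofReal (Real.exp (-(μ / 2))) := by
    rw [poissonLaw, lintegral_pi_fin_prod _
      (fun _ k => ENNReal.ofReal (if k = 0 then 1 else Real.exp (-1)))
      fun i => measurable_of_countable _]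
    refine (Finset.prod_le_prod' fun i _ => lintegral_exp_neg_indicator_le (hm i)).trans ?_
    rw [← ENNReal.ofReal_prod_of_nonneg fun i _ => (Real.exp_pos _).le, ← Real.exp_sum,
      Finset.sum_neg_distrib, ← Finset.sum_div]
  calc ∫⁻ x, ENNReal.ofReal (μ / sHat x) ∂(poissonLaw m)
      ≤ ∫⁻ x, (4 + ENNReal.ofReal (μ * Real.exp (μ / 4)) *
          ∏ i, ENNReal.ofReal (if x i = 0 then 1 else Real.exp (-1))) ∂(poissonLaw m) :=
        lintegral_mono h1
    _ = 4 + ENNReal.ofReal (μ * Real.exp (μ / 4)) *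
          ∫⁻ x, ∏ i, ENNReal.ofReal (if x i = 0 then 1 else Real.exp (-1)) ∂(poissonLaw m) := by
        rw [lintegral_add_left measurable_const, lintegral_const_mul _ (measurable_of_countable _)]
        simp
    _ ≤ 4 + ENNReal.ofReal (μ * Real.exp (μ / 4)) * ENNReal.ofReal (Real.exp (-(μ / 2))) := by
        gcongr
    _ = 4 + ENNReal.ofReal (4 * (μ / 4 * Real.exp (-(μ / 4)))) := by
        rw [← ENNReal.ofReal_mul (by positivity), mul_assoc, ← Real.exp_add]
        ring_nf
    _ ≤ 4 + ENNReal.ofReal 4 := by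
        gcongr
        linarith [mul_exp_neg_le_one (μ / 4)]
    _ = 8 := by norm_num

/-! ### Upper bound for the maximal risk of the plug-in density -/

theorem ae_poissonLaw_eq_zero {n : ℕ} (m : Fin n → ℝ) :
    ∀ᵐ x ∂(poissonLaw m), ∀ i, m i = 0 → x i = 0 := by
  rw [ae_iff_of_countable]
  intro x hx i hi
  rw [poissonLaw_singleton, Finset.prod_ne_zero_iff] at hx
  have h := hx i (Finset.mem_univ i)
  by_contra h0
  refine h ?_
  rw [hi, poissonMeasure_toNNReal_singleton le_rfl, poissonMass, zero_pow h0]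
  simp

/-- Null coordinates have no counts, so `sHat x ≤ k` and the `h K` terms add up to at most `k K`.
The random logarithm is split as `log(n/ŝ) = log(n/k) + log(k/ŝ)`, with `log(k/ŝ) ≤ k/ŝ`. -/
theorem sum_coordLoss_le {n k : ℕ} {κ K : ℝ} {r θ : Fin n → ℝ} (hK : 0 ≤ K)
    (hθ : ∀ i, 0 ≤ θ i) (hk : 1 ≤ k) (hkn : k ≤ n)
    (hcard : (Finset.univ.filter fun i => 0 < θ i).card ≤ k) {x : Fin n → ℕ}
    (hx : ∀ i, θ i = 0 → x i = 0) :
    ∑ i, coordLoss ((sHat x : ℝ) / n) κ K (r i) (θ i) (x i) ≤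
      k * K + (∑ i ∈ Finset.univ.filter (fun i => 0 < θ i),
        signalLoss κ (r i) (θ i) (Real.log (n / k)) (x i)) +
        (∑ i, (1 - Real.exp (-θ i))) * (k / sHat x) := by
  have hs0 : (0 : ℝ) < sHat x := by exact_mod_cast sHat_pos x
  have hk0 : (0 : ℝ) < k := by exact_mod_cast hk
  have hn0 : (0 : ℝ) < n := by exact_mod_cast hk.trans hkn
  have hsk : (sHat x : ℝ) ≤ k := by
    have : sHat x ≤ k := by
      refine max_le hk (le_trans (Finset.card_le_card fun i hi => ?_) hcard)
      simp only [Finset.mem_filter, Finset.mem_univ, true_and] at hi ⊢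
      refine (hθ i).lt_of_ne fun h => ?_
      have := hx i h.symm
      omega
    exact_mod_cast this
  have hlog : Real.log (1 / ((sHat x : ℝ) / n)) ≤ Real.log (n / k) + k / sHat x := by
    have e : 1 / ((sHat x : ℝ) / n) = n / k * (k / sHat x) := by field_simp
    rw [e, Real.log_mul (by positivity) (by positivity)]
    have := Real.log_le_sub_one_of_pos (show 0 < (k : ℝ) / sHat x by positivity)
    linarith
  have hsum : ∑ _i : Fin n, (sHat x : ℝ) / n * K ≤ k * K := by
    rw [Finset.sum_const, Finset.card_univ, Fintype.card_fin, nsmul_eq_mul]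
    have : (n : ℝ) * (sHat x / n * K) = sHat x * K := by field_simp
    rw [this]; gcongr
  have hpt : ∀ i, coordLoss ((sHat x : ℝ) / n) κ K (r i) (θ i) (x i) ≤
      (sHat x : ℝ) / n * K +
        (if 0 < θ i then signalLoss κ (r i) (θ i) (Real.log (n / k)) (x i) else 0) +
        (1 - Real.exp (-θ i)) * (k / sHat x) := by
    intro i
    have hb := one_sub_exp_neg_nonneg (hθ i)
    have hq : 0 < (k : ℝ) / sHat x := by positivity
    unfold coordLoss signalLoss
    rcases (hθ i).eq_or_lt with h0 | h0
    · rw [hx i h0.symm, ← h0]; simp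
    · simp only [h0, if_true]
      split_ifs with h
      · have := mul_le_mul_of_nonneg_left hlog hb
        nlinarith
      · have := mul_nonneg hb hq.le
        have : 0 ≤ (sHat x : ℝ) / n * K := by positivity
        linarith
  refine (Finset.sum_le_sum fun i _ => hpt i).trans ?_
  rw [Finset.sum_add_distrib, Finset.sum_add_distrib, ← Finset.sum_filter, Finset.sum_mul]
  exact add_le_add (add_le_add hsum le_rfl) le_rfl

/-- Bernoulli's inequality with exponent `M`, where `M r₀ ≥ 1`. It compares the chance of a positive
future count with that of a positive past count, as needed to apply `lintegral_div_sHat_le`. -/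
theorem one_sub_exp_neg_le_nat_mul {r₀ r t : ℝ} {M : ℕ} (hM : 1 / r₀ ≤ M) (hr₀ : 0 < r₀)
    (hr : r₀ ≤ r) (ht : 0 ≤ t) : 1 - Real.exp (-t) ≤ M * (1 - Real.exp (-(r * t))) := by
  have h1 := one_add_mul_le_pow (a := Real.exp (-(r₀ * t)) - 1)
    (by linarith [Real.exp_pos (-(r₀ * t))]) M
  have h2 : (1 + (Real.exp (-(r₀ * t)) - 1)) ^ M = Real.exp (-(M * (r₀ * t))) := by
    rw [add_sub_cancel, ← Real.exp_nat_mul]; ring_nf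
  have h3 : Real.exp (-(M * (r₀ * t))) ≤ Real.exp (-t) := by
    rw [div_le_iff₀ hr₀] at hM
    apply Real.exp_le_exp.2
    nlinarith
  have h4 : Real.exp (-(r * t)) ≤ Real.exp (-(r₀ * t)) := by gcongr
  have h5 : (M : ℝ) * Real.exp (-(r * t)) ≤ M * Real.exp (-(r₀ * t)) := by gcongr
  rw [h2] at h1
  nlinarith

/-- The remainder constant in the risk bound of the adaptive predictive density. -/
def remainderConst (κ r₀ : ℝ) : ℝ :=
  gammaInt κ r₀ + (4 + 3 / r₀ + 20 / (κ * r₀)) + 8 * ⌈1 / r₀⌉₊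

theorem remainderConst_nonneg {κ r₀ : ℝ} (hκ : 0 < κ) (hr₀ : 0 < r₀) :
    0 ≤ remainderConst κ r₀ := by
  have := gammaInt_pos hκ hr₀
  unfold remainderConst; positivity

theorem klRisk_adaptivePredictive_le {n k : ℕ} {κ r₀ C : ℝ} {r θ : Fin n → ℝ}
    (hκ : κ ∈ Ioc (0 : ℝ) 1) (hr₀ : 0 < r₀) (hr : ∀ i, r₀ ≤ r i) (hθ : ∀ i, 0 ≤ θ i)
    (hk : 1 ≤ k) (hkn : k ≤ n) (hcard : (Finset.univ.filter fun i => 0 < θ i).card ≤ k)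
    (hC : ∀ t : ℝ, 0 ≤ t → Real.exp (-(r₀ * t)) * (1 - Real.exp (-t)) ≤ C) :
    klRisk r θ (adaptivePredictive κ r) ≤
      ENNReal.ofReal (k * (C * Real.log (n / k) + remainderConst κ r₀)) := by
  have hr0 : ∀ i, 0 < r i := fun i => hr₀.trans_le (hr i)
  have hκ0 := hκ.1
  have hk0 : (0 : ℝ) < k := by exact_mod_cast hk
  have hn0 : 0 < n := hk.trans hkn
  have hC0 : 0 ≤ C := by simpa using hC 0 le_rfl
  have hg := gammaInt_pos hκ0 hr₀
  have hℓ : 0 ≤ Real.log ((n : ℝ) / k) := by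
    refine Real.log_nonneg ?_
    rw [one_le_div hk0]; exact_mod_cast hkn
  set ℓ := Real.log ((n : ℝ) / k)
  set S := Finset.univ.filter fun i => 0 < θ i
  set M := ⌈1 / r₀⌉₊
  set K' := 4 + 3 / r₀ + 20 / (κ * r₀) with hK'
  have hK'0 : 0 ≤ K' := by positivity
  have hm : ∀ i, 0 ≤ r i * θ i := fun i => mul_nonneg (hr0 i).le (hθ i)
  have hb := fun i => one_sub_exp_neg_nonneg (hθ i)
  set μ := ∑ i, (1 - Real.exp (-(r i * θ i)))
  have hsum : ∑ i, (1 - Real.exp (-θ i)) ≤ M * μ := by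
    rw [Finset.mul_sum]
    exact Finset.sum_le_sum fun i _ =>
      one_sub_exp_neg_le_nat_mul (Nat.le_ceil _) hr₀ (hr i) (hθ i)
  have hae : ∀ᵐ x ∂(poissonLaw fun i => r i * θ i),
      InformationTheory.klDiv (poissonLaw θ) (adaptivePredictive κ r x) ≤
        ENNReal.ofReal (k * gammaInt κ r₀) +
          ∑ i ∈ S, ENNReal.ofReal (signalLoss κ (r i) (θ i) ℓ (x i)) +
          ENNReal.ofReal (k * M) * ENNReal.ofReal (μ / sHat x) := by
    filter_upwards [ae_poissonLaw_eq_zero fun i => r i * θ i] with x hx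
    have hx' : ∀ i, θ i = 0 → x i = 0 := fun i hi => hx i (by simp [hi])
    have hs0 : (0 : ℝ) < sHat x := by exact_mod_cast sHat_pos x
    refine (klDiv_adaptivePredictive_le hn0 hκ hr₀ hr hθ x).trans ?_
    refine (ENNReal.ofReal_le_ofReal
      (sum_coordLoss_le hg.le hθ hk hkn hcard hx')).trans ?_
    refine ENNReal.ofReal_add_le.trans (add_le_add (ENNReal.ofReal_add_le.trans
      (add_le_add le_rfl ?_)) ?_)
    · rw [ENNReal.ofReal_sum_of_nonneg fun i hi =>
        signalLoss_nonneg hκ0 (hr0 i) (Finset.mem_filter.1 hi).2 hℓ _]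
    · rw [← ENNReal.ofReal_mul (by positivity)]
      refine ENNReal.ofReal_le_ofReal ?_
      calc _ ≤ M * μ * (k / sHat x) := by gcongr
        _ = _ := by ring
  have hsig : ∀ i ∈ S, ∫⁻ x, ENNReal.ofReal (signalLoss κ (r i) (θ i) ℓ (x i))
      ∂(poissonLaw fun i => r i * θ i) ≤ ENNReal.ofReal (C * ℓ + K') := fun i hi => by
    rw [lintegral_eval_poissonLaw (fun i => r i * θ i) i
      fun x => ENNReal.ofReal (signalLoss κ (r i) (θ i) ℓ x)]
    exact lintegral_signalLoss_le hκ hr₀ (hr i) (Finset.mem_filter.1 hi).2 hℓ hC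
  calc klRisk r θ (adaptivePredictive κ r)
      ≤ ∫⁻ x, (ENNReal.ofReal (k * gammaInt κ r₀) +
          ∑ i ∈ S, ENNReal.ofReal (signalLoss κ (r i) (θ i) ℓ (x i)) +
          ENNReal.ofReal (k * M) * ENNReal.ofReal (μ / sHat x))
          ∂(poissonLaw fun i => r i * θ i) := lintegral_mono_ae hae
    _ = ENNReal.ofReal (k * gammaInt κ r₀) +
          ∑ i ∈ S, ∫⁻ x, ENNReal.ofReal (signalLoss κ (r i) (θ i) ℓ (x i))
            ∂(poissonLaw fun i => r i * θ i) +
          ENNReal.ofReal (k * M) * ∫⁻ x, ENNReal.ofReal (μ / sHat x)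
            ∂(poissonLaw fun i => r i * θ i) := by
        rw [lintegral_add_left (measurable_of_countable _), lintegral_add_left measurable_const,
          lintegral_finsetSum _ fun i _ => measurable_of_countable _,
          lintegral_const_mul _ (measurable_of_countable _)]
        simp
    _ ≤ ENNReal.ofReal (k * gammaInt κ r₀) + ∑ _i ∈ S, ENNReal.ofReal (C * ℓ + K') +
          ENNReal.ofReal (k * M) * 8 := by
        gcongr with i hi
        · exact hsig i hi
        · exact lintegral_div_sHat_le hm
    _ ≤ ENNReal.ofReal (k * gammaInt κ r₀) + ENNReal.ofReal (k * (C * ℓ + K')) +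
          ENNReal.ofReal (k * M * 8) := by
        rw [Finset.sum_const, nsmul_eq_mul, ENNReal.ofReal_mul (q := C * ℓ + K') hk0.le,
          ENNReal.ofReal_natCast,
          ENNReal.ofReal_mul (p := k * M) (by positivity)]
        have h8 : (8 : ℝ≥0∞) ≤ ENNReal.ofReal 8 := by simp
        have hc : (S.card : ℝ≥0∞) ≤ k := by exact_mod_cast hcard
        gcongr
    _ = _ := by
        rw [← ENNReal.ofReal_add (by positivity) (by positivity),
          ← ENNReal.ofReal_add (by positivity) (by positivity), remainderConst]
        congr 1
        ring

/-- Support sizes are integers, so `s` may be replaced by its floor, which is also the number of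
blocks in the lower bound. -/
theorem maxRisk_adaptivePredictive_le {n : ℕ} {κ r₀ C s : ℝ} {r : Fin n → ℝ}
    (hκ : κ ∈ Ioc (0 : ℝ) 1) (hr₀ : 0 < r₀) (hr : ∀ i, r₀ ≤ r i) (hs : 1 ≤ s) (hsn : s ≤ n)
    (hC : ∀ t : ℝ, 0 ≤ t → Real.exp (-(r₀ * t)) * (1 - Real.exp (-t)) ≤ C) :
    maxRisk r s (adaptivePredictive κ r) ≤
      ENNReal.ofReal (⌊s⌋₊ * (C * Real.log (n / ⌊s⌋₊) + remainderConst κ r₀)) := by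
  refine iSup₂_le fun θ hθ => klRisk_adaptivePredictive_le hκ hr₀ hr hθ.1
    (Nat.le_floor (by simpa using hs)) (Nat.floor_le_of_le hsn) (Nat.le_floor hθ.2) hC

/-! ### Lower bounds for the minimax risk from finite priors -/

theorem ofReal_integral_le_lintegral {α : Type*} [MeasurableSpace α] {μ : Measure α} {g : α → ℝ}
    (hg : Integrable g μ) : ENNReal.ofReal (∫ x, g x ∂μ) ≤ ∫⁻ x, ENNReal.ofReal (g x) ∂μ := by
  refine (ENNReal.ofReal_le_ofReal (integral_mono hg hg.pos_part fun x => le_max_left _ _)).trans ?_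
  rw [ofReal_integral_eq_lintegral_ofReal hg.pos_part (ae_of_all _ fun x => le_max_right _ _)]
  refine lintegral_mono fun x => ?_
  simp [ENNReal.ofReal_max]

/-- A lower bound for the minimax risk from the uniform prior on a finite family of parameters. -/
theorem ofReal_le_minimaxRisk {n : ℕ} {r : Fin n → ℝ} {s V B : ℝ} {ι : Type*} [Fintype ι]
    [Nonempty ι] (θ : ι → Fin n → ℝ) (hθ : ∀ j, θ j ∈ sparseSpace n s)
    (f : ι → (Fin n → ℕ) → (Fin n → ℕ) → ℝ) (hB : ∀ j x y, |f j x y| ≤ B)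
    (hcond : ∀ x y, ∑ j, poissonLaw (fun i => r i * θ j i) {x} * ENNReal.ofReal (Real.exp (f j x y))
      ≤ ∑ j, poissonLaw (fun i => r i * θ j i) {x})
    (hV : ∀ j, V ≤ ∫ x, ∫ y, f j x y ∂(poissonLaw (θ j)) ∂(poissonLaw fun i => r i * θ j i)) :
    ENNReal.ofReal V ≤ minimaxRisk r s := by
  refine le_iInf fun q => ?_
  set Q : (Fin n → ℕ) → Measure (Fin n → ℕ) := fun x => (q x).toMeasure with hQ
  set p : ι → Measure (Fin n → ℕ) := fun j => poissonLaw fun i => r i * θ j i with hp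
  set R := maxRisk r s Q with hR
  have hQp : ∀ x, IsProbabilityMeasure (Q x) := fun x => by rw [hQ]; infer_instance
  have hpp : ∀ j, IsProbabilityMeasure (p j) := fun j => by rw [hp]; infer_instance
  have hfint : ∀ j x (ν : Measure (Fin n → ℕ)) [IsProbabilityMeasure ν], Integrable (f j x) ν :=
    fun j x ν _ => Integrable.of_bound (measurable_of_countable _).aestronglyMeasurable B
      (ae_of_all _ fun y => hB j x y)
  have heint : ∀ j x (ν : Measure (Fin n → ℕ)) [IsProbabilityMeasure ν],
      Integrable (fun y => Real.exp (f j x y)) ν :=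
    fun j x ν _ => Integrable.of_bound (measurable_of_countable _).aestronglyMeasurable (Real.exp B)
      (ae_of_all _ fun y => by
        rw [Real.norm_of_nonneg (Real.exp_nonneg _)]
        exact Real.exp_le_exp.2 ((le_abs_self _).trans (hB j x y)))
  have hinner : ∀ j x, |∫ y, f j x y ∂(poissonLaw (θ j))| ≤ B := fun j x => by
    have := norm_integral_le_of_norm_le_const (μ := poissonLaw (θ j)) (f := f j x) (C := B)
      (ae_of_all _ fun y => hB j x y)
    simpa using this
  -- The variational inequality with test function `f j x`, integrated over the observation `x`.
  have hone : ∀ j, ENNReal.ofReal (V + 1) ≤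
      R + ∫⁻ x, ∫⁻ y, ENNReal.ofReal (Real.exp (f j x y)) ∂(Q x) ∂(p j) := fun j => by
    have hi : Integrable (fun x => ∫ y, f j x y ∂(poissonLaw (θ j))) (p j) :=
      Integrable.of_bound (measurable_of_countable _).aestronglyMeasurable B
        (ae_of_all _ fun x => hinner j x)
    calc ENNReal.ofReal (V + 1)
        ≤ ENNReal.ofReal (∫ x, (∫ y, f j x y ∂(poissonLaw (θ j)) + 1) ∂(p j)) := by
          refine ENNReal.ofReal_le_ofReal ?_
          rw [integral_add hi (integrable_const 1)]
          simpa using hV j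
      _ ≤ ∫⁻ x, ENNReal.ofReal (∫ y, f j x y ∂(poissonLaw (θ j)) + 1) ∂(p j) :=
          ofReal_integral_le_lintegral (hi.add (integrable_const 1))
      _ ≤ ∫⁻ x, (InformationTheory.klDiv (poissonLaw (θ j)) (Q x) +
            ∫⁻ y, ENNReal.ofReal (Real.exp (f j x y)) ∂(Q x)) ∂(p j) :=
          lintegral_mono fun x =>
            ofReal_integral_add_one_le_klDiv_add _ _ _ (hfint j x _) (heint j x _)
      _ = klRisk r (θ j) Q + ∫⁻ x, ∫⁻ y, ENNReal.ofReal (Real.exp (f j x y)) ∂(Q x) ∂(p j) :=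
          lintegral_add_left (measurable_of_countable _) _
      _ ≤ _ := by
          gcongr
          exact le_iSup₂ (f := fun θ (_ : θ ∈ sparseSpace n s) => klRisk r θ Q) (θ j) (hθ j)
  -- After summing over `j` first, `hcond` bounds the integrand for every `y`, so only the total
  -- mass of `Q x` matters. Averaging over `j` then turns this term into the 1 that cancels the one
  -- in `V + 1`.
  have hsum : ∑ j, ∫⁻ x, ∫⁻ y, ENNReal.ofReal (Real.exp (f j x y)) ∂(Q x) ∂(p j) ≤
      Fintype.card ι := by
    calc ∑ j, ∫⁻ x, ∫⁻ y, ENNReal.ofReal (Real.exp (f j x y)) ∂(Q x) ∂(p j)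
        = ∑ j, ∑' x, (∫⁻ y, ENNReal.ofReal (Real.exp (f j x y)) ∂(Q x)) * p j {x} := by
          simp_rw [lintegral_countable']
      _ = ∑' x, ∑ j, (∫⁻ y, ENNReal.ofReal (Real.exp (f j x y)) ∂(Q x)) * p j {x} :=
          (Summable.tsum_finsetSum fun _ _ => ENNReal.summable).symm
      _ = ∑' x, ∫⁻ y, ∑ j, p j {x} * ENNReal.ofReal (Real.exp (f j x y)) ∂(Q x) := by
          refine tsum_congr fun x => ?_
          rw [lintegral_finsetSum _ fun j _ => measurable_of_countable _]
          refine Finset.sum_congr rfl fun j _ => ?_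
          rw [lintegral_const_mul _ (measurable_of_countable _), mul_comm]
      _ ≤ ∑' x, ∑ j, p j {x} := by
          refine ENNReal.tsum_le_tsum fun x => ?_
          refine (lintegral_mono fun y => hcond x y).trans ?_
          simp [hp]
      _ = ∑ j, ∑' x, p j {x} := Summable.tsum_finsetSum fun _ _ => ENNReal.summable
      _ = Fintype.card ι := by
          have h1 : ∀ j, ∑' x, p j {x} = 1 := fun j => by
            have := Measure.tsum_indicator_apply_singleton (p j) univ MeasurableSet.univ
            simpa using this
          simp [h1]
  have hN0 : (Fintype.card ι : ℝ≥0∞) ≠ 0 := by simp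
  have hNt : (Fintype.card ι : ℝ≥0∞) ≠ ⊤ := ENNReal.natCast_ne_top _
  have htot : (Fintype.card ι : ℝ≥0∞) * ENNReal.ofReal (V + 1) ≤ Fintype.card ι * (R + 1) := by
    calc (Fintype.card ι : ℝ≥0∞) * ENNReal.ofReal (V + 1)
        = ∑ _j : ι, ENNReal.ofReal (V + 1) := by simp
      _ ≤ ∑ j, (R + ∫⁻ x, ∫⁻ y, ENNReal.ofReal (Real.exp (f j x y)) ∂(Q x) ∂(p j)) :=
          Finset.sum_le_sum fun j _ => hone j
      _ ≤ Fintype.card ι * R + Fintype.card ι := by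
          rw [Finset.sum_add_distrib]
          gcongr
          simp
      _ = _ := by ring
  have h1 : ENNReal.ofReal (V + 1) ≤ R + 1 := (ENNReal.mul_le_mul_iff_right hN0 hNt).1 htot
  rcases le_or_gt V 0 with h | h
  · simp [ENNReal.ofReal_of_nonpos h]
  · rw [ENNReal.ofReal_add h.le zero_le_one, ENNReal.ofReal_one] at h1
    exact (ENNReal.add_le_add_iff_right ENNReal.one_ne_top).1 h1

/-! ### The block prior: one hidden spike per block -/

section Blocks

variable {n k L : ℕ}

/-- The parameter with one spike `lam` in each block `b`, at position `j b`. -/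
def spikes (e : Fin k × Fin L → Fin n) (lam : ℝ) (j : Fin k → Fin L) (i : Fin n) : ℝ :=
  open scoped Classical in if ∃ b, e (b, j b) = i then lam else 0

/-- All observations in block `b` vanish. -/
def BlockSilent (e : Fin k × Fin L → Fin n) (b : Fin k) (x : Fin n → ℕ) : Prop :=
  ∀ l, x (e (b, l)) = 0

/-- In block `b`, exactly the count at position `l` is positive. -/
def BlockHit (e : Fin k × Fin L → Fin n) (b : Fin k) (l : Fin L) (y : Fin n → ℕ) : Prop :=
  y (e (b, l)) ≠ 0 ∧ ∀ l', l' ≠ l → y (e (b, l')) = 0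

theorem spikes_apply {e : Fin k × Fin L → Fin n} (he : Function.Injective e) (lam : ℝ)
    (j : Fin k → Fin L) (b : Fin k) (l : Fin L) :
    spikes e lam j (e (b, l)) = if l = j b then lam else 0 := by
  unfold spikes
  congr 1
  refine propext ⟨fun ⟨_, hb'⟩ => ?_, fun h => ⟨b, by rw [h]⟩⟩
  have := he hb'
  simp only [Prod.mk.injEq] at this
  rw [← this.2, this.1]

theorem spikes_of_not_mem_range {e : Fin k × Fin L → Fin n} (lam : ℝ) (j : Fin k → Fin L)
    {i : Fin n} (hi : i ∉ Set.range e) : spikes e lam j i = 0 :=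
  if_neg fun ⟨_, hb⟩ => hi ⟨_, hb⟩

theorem spikes_mem_sparseSpace (e : Fin k × Fin L → Fin n) {lam s : ℝ} (hlam : 0 ≤ lam)
    (hks : (k : ℝ) ≤ s) (j : Fin k → Fin L) : spikes e lam j ∈ sparseSpace n s := by
  refine ⟨fun i => ?_, le_trans ?_ hks⟩
  · unfold spikes; split_ifs <;> simp [hlam]
  · have h1 : (Finset.univ.filter fun i => 0 < spikes e lam j i) ⊆
        Finset.univ.image fun b => e (b, j b) := fun i hi => by
      simp only [Finset.mem_filter, Finset.mem_univ, true_and] at hi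
      rw [Finset.mem_image]
      by_contra h
      refine hi.ne' (if_neg fun ⟨b, hb⟩ => h ⟨b, Finset.mem_univ _, hb⟩)
    have h2 := (Finset.card_le_card h1).trans Finset.card_image_le
    rw [Finset.card_univ, Fintype.card_fin] at h2
    exact_mod_cast h2

open scoped Classical in
/-- The normalized likelihood-ratio weight of position `l` in block `b`. -/
def blockWeight (e : Fin k × Fin L → Fin n) (D : ℝ) (b : Fin k) (l : Fin L)
    (x y : Fin n → ℕ) : ℝ :=
  (if BlockSilent e b x ∧ BlockHit e b l y then (L : ℝ) else 1) / D

/-- The likelihood of the observations in block `b` when the spike is at position `l`. -/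
def blockLikelihood (e : Fin k × Fin L → Fin n) (r : Fin n → ℝ) (lam : ℝ) (x : Fin n → ℕ)
    (b : Fin k) (l : Fin L) : ℝ≥0∞ :=
  ∏ l', poissonMeasure (r (e (b, l')) * if l' = l then lam else 0).toNNReal {x (e (b, l'))}

-- Coordinates outside the blocks contribute a factor free of `j`, and each block sees only its own
-- spike, so sums over `j` factor over the blocks.
open scoped Classical in
theorem poissonLaw_spikes {e : Fin k × Fin L → Fin n} (he : Function.Injective e) (r : Fin n → ℝ)
    (lam : ℝ) (j : Fin k → Fin L) (x : Fin n → ℕ) :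
    poissonLaw (fun i => r i * spikes e lam j i) {x} =
      (∏ i ∈ Finset.univ.filter (fun i => i ∉ Set.range e), poissonMeasure (0 : ℝ).toNNReal {x i}) *
        ∏ b, blockLikelihood e r lam x b (j b) := by
  rw [poissonLaw_singleton, ← Finset.prod_filter_not_mul_prod_filter _ fun i => i ∈ Set.range e]
  congr 1
  · refine Finset.prod_congr rfl fun i hi => ?_
    rw [spikes_of_not_mem_range lam j (Finset.mem_filter.1 hi).2, mul_zero]
  · have h1 : Finset.univ.filter (fun i => i ∈ Set.range e) = Finset.univ.image e := by
      ext i; simp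
    rw [h1, Finset.prod_image fun _ _ _ _ h => he h, ← Finset.univ_product_univ,
      Finset.prod_product]
    refine Finset.prod_congr rfl fun b _ => Finset.prod_congr rfl fun l _ => ?_
    rw [spikes_apply he]

theorem blockLikelihood_of_silent {e : Fin k × Fin L → Fin n} {r : Fin n → ℝ} {lam : ℝ}
    (hr : ∀ p, 0 ≤ r (e p)) (hlam : 0 ≤ lam) {x : Fin n → ℕ} {b : Fin k}
    (hx : BlockSilent e b x) (l : Fin L) :
    blockLikelihood e r lam x b l = ENNReal.ofReal (Real.exp (-(r (e (b, l)) * lam))) := by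
  unfold blockLikelihood
  rw [Finset.prod_eq_single l]
  · rw [if_pos rfl, hx l, poissonMeasure_toNNReal_singleton (mul_nonneg (hr _) hlam)]
    simp [poissonMass]
  · intro l' _ hl'
    rw [if_neg hl', hx l', mul_zero, poissonMeasure_toNNReal_singleton le_rfl]
    simp [poissonMass]
  · simp

/-- On a silent block the likelihoods of any two positions differ by a factor at most `e^{δ lam}`,
so `L` times one of them is at most `e^{δ lam}` times their sum. At most one position can be hit and
receive the weight `L`; hence the normaliser `1 + e^{δ lam}`. In all other cases every weight is at
most 1. -/
theorem sum_blockLikelihood_mul_le {e : Fin k × Fin L → Fin n} {r : Fin n → ℝ} {lam r₀ δ : ℝ}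
    (hr₀ : 0 ≤ r₀) (hr : ∀ p, r (e p) ∈ Icc r₀ (r₀ + δ)) (hlam : 0 ≤ lam) (x y : Fin n → ℕ)
    (b : Fin k) :
    ∑ l, blockLikelihood e r lam x b l *
        ENNReal.ofReal (blockWeight e (1 + Real.exp (δ * lam)) b l x y) ≤
      ∑ l, blockLikelihood e r lam x b l := by
  have hD : (1 : ℝ) ≤ 1 + Real.exp (δ * lam) := by linarith [Real.exp_pos (δ * lam)]
  set D := 1 + Real.exp (δ * lam) with hDdef
  have hD0 : 0 < D := by linarith
  by_cases hx : BlockSilent e b x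
  swap
  · refine Finset.sum_le_sum fun l _ => mul_le_of_le_one_right' ?_
    rw [ENNReal.ofReal_le_one, blockWeight, if_neg fun h => hx h.1]
    rw [div_le_one hD0]; exact hD
  · simp_rw [blockLikelihood_of_silent (fun p => hr₀.trans (hr p).1) hlam hx]
    set w : Fin L → ℝ := fun l => Real.exp (-(r (e (b, l)) * lam)) with hw
    have hw0 : ∀ l, 0 ≤ w l := fun l => (Real.exp_pos _).le
    have hφ0 : ∀ l, 0 ≤ blockWeight e D b l x y := fun l => by
      unfold blockWeight; split_ifs <;> positivity
    have hww : ∀ l l', w l ≤ Real.exp (δ * lam) * w l' := fun l l' => by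
      simp only [hw]
      rw [← Real.exp_add]
      refine Real.exp_le_exp.2 ?_
      nlinarith [(hr (b, l)).1, (hr (b, l')).2]
    have hreal : ∑ l, w l * blockWeight e D b l x y ≤ ∑ l, w l := by
      have hW : 0 ≤ ∑ l, w l := Finset.sum_nonneg fun l _ => hw0 l
      by_cases hy : ∃ l, BlockHit e b l y
      · obtain ⟨l₀, hl₀⟩ := hy
        have hle : ∀ l, w l * blockWeight e D b l x y ≤
            (w l + if l = l₀ then L * w l else 0) / D := fun l => by
          unfold blockWeight
          rw [mul_div_assoc']
          refine div_le_div_of_nonneg_right ?_ hD0.le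
          by_cases h : l = l₀
          · simp only [h, if_true]
            split_ifs
            · linarith [hw0 l₀]
            · have : 0 ≤ (L : ℝ) * w l₀ := mul_nonneg (Nat.cast_nonneg _) (hw0 _)
              linarith
          · have : ¬ BlockHit e b l y := fun h' => h'.1 (hl₀.2 l h)
            simp [h, this]
        refine (Finset.sum_le_sum fun l _ => hle l).trans ?_
        rw [← Finset.sum_div, Finset.sum_add_distrib, div_le_iff₀ hD0]
        have h1 : (L : ℝ) * w l₀ ≤ Real.exp (δ * lam) * ∑ l, w l := by
          rw [Finset.mul_sum]
          have := Finset.card_nsmul_le_sum Finset.univ (fun l => Real.exp (δ * lam) * w l) (w l₀)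
            fun l _ => hww l₀ l
          simpa using this
        simp only [Finset.sum_ite_eq', Finset.mem_univ, if_true]
        rw [hDdef]
        linarith
      · refine Finset.sum_le_sum fun l _ => mul_le_of_le_one_right (hw0 l) ?_
        rw [blockWeight, if_neg fun h => hy ⟨l, h.2⟩, div_le_one hD0]
        exact hD
    have hmul : ∀ l, ENNReal.ofReal (Real.exp (-(r (e (b, l)) * lam))) *
        ENNReal.ofReal (blockWeight e D b l x y) = ENNReal.ofReal (w l * blockWeight e D b l x y) :=
      fun l => (ENNReal.ofReal_mul (hw0 l)).symm
    rw [Finset.sum_congr rfl fun l _ => hmul l, ← ENNReal.ofReal_sum_of_nonneg fun l _ => mul_nonneg (hw0 l) (hφ0 l),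
      ← ENNReal.ofReal_sum_of_nonneg fun l _ => hw0 l]
    exact ENNReal.ofReal_le_ofReal hreal

end Blocks

/-! ### The risk bound from the block prior -/

section Blocks

variable {n k L : ℕ}

theorem integrable_indicator_count (ν : Measure (Fin n → ℕ)) [IsProbabilityMeasure ν]
    (q : (Fin n → ℕ) → Prop) [DecidablePred q] :
    Integrable (fun x => if q x then (1 : ℝ) else 0) ν :=
  Integrable.of_bound (measurable_of_countable _).aestronglyMeasurable 1
    (ae_of_all _ fun x => by split_ifs <;> simp)

-- The other positions of the block have mean zero, so the block is almost surely silent as soon as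
-- the spike is.
open scoped Classical in
theorem integral_blockSilent_ge {e : Fin k × Fin L → Fin n} (he : Function.Injective e)
    {r : Fin n → ℝ} {lam : ℝ} (hr : ∀ p, 0 ≤ r (e p)) (hlam : 0 ≤ lam) (j : Fin k → Fin L)
    (b : Fin k) :
    Real.exp (-(r (e (b, j b)) * lam)) ≤
      ∫ x, (if BlockSilent e b x then (1 : ℝ) else 0)
        ∂(poissonLaw fun i => r i * spikes e lam j i) := by
  set p := poissonLaw fun i => r i * spikes e lam j i
  have hm : r (e (b, j b)) * spikes e lam j (e (b, j b)) = r (e (b, j b)) * lam := by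
    rw [spikes_apply he, if_pos rfl]
  have h1 := (poisson_zero_indicator (mul_nonneg (hr (b, j b)) hlam)).2
  have h2 := integral_eval_poissonLaw (fun i => r i * spikes e lam j i) (e (b, j b))
    fun k => if k = 0 then (1 : ℝ) else 0
  rw [hm, h1] at h2
  rw [← h2]
  refine integral_mono_ae (integrable_indicator_count _ _) (integrable_indicator_count _ _) ?_
  filter_upwards [ae_poissonLaw_eq_zero fun i => r i * spikes e lam j i] with x hx
  by_cases h0 : x (e (b, j b)) = 0
  · have : BlockSilent e b x := fun l => by
      by_cases hl : l = j b
      · rw [hl]; exact h0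
      · exact hx _ (by rw [spikes_apply he, if_neg hl, mul_zero])
    simp [this, h0]
  · simp only [h0, if_false]
    split_ifs <;> norm_num

open scoped Classical in
theorem integral_blockHit_ge {e : Fin k × Fin L → Fin n} (he : Function.Injective e)
    {lam : ℝ} (hlam : 0 ≤ lam) (j : Fin k → Fin L) (b : Fin k) :
    1 - Real.exp (-lam) ≤
      ∫ y, (if BlockHit e b (j b) y then (1 : ℝ) else 0) ∂(poissonLaw (spikes e lam j)) := by
  set p := poissonLaw (spikes e lam j)
  have h2 := integral_eval_poissonLaw (spikes e lam j) (e (b, j b))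
    fun k => if k = 0 then (1 : ℝ) else 0
  rw [spikes_apply he, if_pos rfl, (poisson_zero_indicator hlam).2] at h2
  have h3 : ∫ y, (1 - if y (e (b, j b)) = 0 then (1 : ℝ) else 0) ∂p = 1 - Real.exp (-lam) := by
    rw [integral_sub (integrable_const 1)
      (integrable_indicator_count p fun y => y (e (b, j b)) = 0), h2]
    simp
  rw [← h3]
  refine integral_mono_ae ((integrable_const 1).sub (integrable_indicator_count _ _)) (integrable_indicator_count _ _) ?_
  filter_upwards [ae_poissonLaw_eq_zero (spikes e lam j)] with y hy
  by_cases h0 : y (e (b, j b)) = 0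
  · simp only [h0, if_true, sub_self]
    split_ifs <;> norm_num
  · have : BlockHit e b (j b) y :=
      ⟨h0, fun l hl => hy _ (by rw [spikes_apply he, if_neg hl])⟩
    simp [this, h0]

theorem sum_prod_blockWeight_le {e : Fin k × Fin L → Fin n} (he : Function.Injective e)
    {r : Fin n → ℝ} {lam r₀ δ : ℝ} (hr₀ : 0 ≤ r₀) (hr : ∀ p, r (e p) ∈ Icc r₀ (r₀ + δ))
    (hlam : 0 ≤ lam) (x y : Fin n → ℕ) :
    ∑ j, poissonLaw (fun i => r i * spikes e lam j i) {x} *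
        ENNReal.ofReal (∏ b, blockWeight e (1 + Real.exp (δ * lam)) b (j b) x y) ≤
      ∑ j, poissonLaw (fun i => r i * spikes e lam j i) {x} := by
  have hφ0 : ∀ b l, 0 ≤ blockWeight e (1 + Real.exp (δ * lam)) b l x y := fun b l => by
    unfold blockWeight; split_ifs <;> positivity
  have hswap : ∀ F : Fin k → Fin L → ℝ≥0∞, ∑ j : Fin k → Fin L, ∏ b, F b (j b) = ∏ b, ∑ l, F b l :=
    fun F => by rw [Finset.prod_univ_sum, Fintype.piFinset_univ]
  simp_rw [poissonLaw_spikes he, fun j : Fin k → Fin L =>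
    ENNReal.ofReal_prod_of_nonneg (s := Finset.univ) fun b _ => hφ0 b (j b), mul_assoc,
    ← Finset.prod_mul_distrib, ← Finset.mul_sum]
  rw [hswap fun b l => blockLikelihood e r lam x b l *
    ENNReal.ofReal (blockWeight e (1 + Real.exp (δ * lam)) b l x y),
    hswap fun b l => blockLikelihood e r lam x b l]
  refine mul_le_mul_right (Finset.prod_le_prod' fun b _ => ?_) _
  exact sum_blockLikelihood_mul_le hr₀ hr hlam x y b

/-- The test function gains `log L` in each block that is silent in the past and hit at the spike in
the future, and always pays the logarithm of the normaliser. Past and future are independent, so the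
mean gain factors. -/
theorem ofReal_le_minimaxRisk_of_blocks {e : Fin k × Fin L → Fin n} (he : Function.Injective e)
    {r : Fin n → ℝ} {lam r₀ δ s : ℝ} (hr₀ : 0 ≤ r₀) (hr : ∀ p, r (e p) ∈ Icc r₀ (r₀ + δ))
    (hlam : 0 ≤ lam) (hL : 1 ≤ L) (hks : (k : ℝ) ≤ s) :
    ENNReal.ofReal (k * (Real.exp (-((r₀ + δ) * lam)) * (1 - Real.exp (-lam)) * Real.log L -
      Real.log (1 + Real.exp (δ * lam)))) ≤ minimaxRisk r s := by
  classical
  have hL0 : (0 : ℝ) < L := by exact_mod_cast hL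
  have hlogL : 0 ≤ Real.log L := Real.log_natCast_nonneg L
  have : Nonempty (Fin L) := ⟨⟨0, hL⟩⟩
  set D := 1 + Real.exp (δ * lam) with hDdef
  have hD0 : 0 < D := by positivity
  have hlogD : 0 ≤ Real.log D := Real.log_nonneg (by linarith [Real.exp_pos (δ * lam)])
  set A : Fin k → (Fin n → ℕ) → ℝ := fun b x => if BlockSilent e b x then 1 else 0 with hA
  set H : Fin k → Fin L → (Fin n → ℕ) → ℝ := fun b l y => if BlockHit e b l y then 1 else 0 with hH
  set f : (Fin k → Fin L) → (Fin n → ℕ) → (Fin n → ℕ) → ℝ := fun j x y =>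
    ∑ b, (Real.log L * A b x * H b (j b) y - Real.log D) with hf
  have hA01 : ∀ b x, 0 ≤ A b x ∧ A b x ≤ 1 := fun b x => by
    simp only [hA]; split_ifs <;> simp
  have hH01 : ∀ b l x, 0 ≤ H b l x ∧ H b l x ≤ 1 := fun b l x => by
    simp only [hH]; split_ifs <;> simp
  have hAint : ∀ b (ν : Measure (Fin n → ℕ)) [IsProbabilityMeasure ν], Integrable (A b) ν :=
    fun b ν _ => integrable_indicator_count ν _
  have hHint : ∀ b l (ν : Measure (Fin n → ℕ)) [IsProbabilityMeasure ν], Integrable (H b l) ν :=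
    fun b l ν _ => integrable_indicator_count ν _
  have hexp : ∀ j x y, Real.exp (f j x y) = ∏ b, blockWeight e D b (j b) x y := fun j x y => by
    rw [hf, Real.exp_sum]
    refine Finset.prod_congr rfl fun b _ => ?_
    rw [Real.exp_sub, Real.exp_log hD0, blockWeight]
    congr 1
    by_cases h1 : BlockSilent e b x <;> by_cases h2 : BlockHit e b (j b) y <;>
      simp [hA, hH, h1, h2, Real.exp_log hL0]
  refine ofReal_le_minimaxRisk (B := ∑ _b : Fin k, (Real.log L + Real.log D)) (spikes e lam)
    (spikes_mem_sparseSpace e hlam hks) f (fun j x y => ?_) (fun x y => ?_) fun j => ?_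
  · refine (Finset.abs_sum_le_sum_abs _ _).trans (Finset.sum_le_sum fun b _ => ?_)
    have h1 := hA01 b x
    have h2 := hH01 b (j b) y
    have h3 : A b x * H b (j b) y ≤ 1 := mul_le_one₀ h1.2 h2.1 h2.2
    have h4 : 0 ≤ A b x * H b (j b) y := mul_nonneg h1.1 h2.1
    rw [mul_assoc, abs_le]
    constructor <;> nlinarith
  · simp_rw [hexp]
    exact sum_prod_blockWeight_le he hr₀ hr hlam x y
  · have hinner : ∀ x, ∫ y, f j x y ∂(poissonLaw (spikes e lam j)) =
        ∑ b, (Real.log L * A b x * ∫ y, H b (j b) y ∂(poissonLaw (spikes e lam j)) -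
          Real.log D) := fun x => by
      have hs : ∀ b ∈ Finset.univ, Integrable (fun y => Real.log L * A b x * H b (j b) y -
          Real.log D) (poissonLaw (spikes e lam j)) := fun b _ =>
        ((hHint b (j b) _).const_mul _).sub (integrable_const _)
      rw [hf, integral_finsetSum _ hs]
      refine Finset.sum_congr rfl fun b _ => ?_
      rw [integral_sub ((hHint b (j b) _).const_mul _) (integrable_const _), integral_const_mul]
      simp
    simp_rw [hinner]
    have hi : ∀ b, Integrable (fun x => Real.log L * A b x *
        ∫ y, H b (j b) y ∂(poissonLaw (spikes e lam j)))
        (poissonLaw fun i => r i * spikes e lam j i) := fun b =>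
      ((hAint b _).const_mul _).mul_const _
    have hs : ∀ b ∈ Finset.univ, Integrable (fun x => Real.log L * A b x *
        ∫ y, H b (j b) y ∂(poissonLaw (spikes e lam j)) - Real.log D)
        (poissonLaw fun i => r i * spikes e lam j i) := fun b _ =>
      (hi b).sub (integrable_const _)
    rw [integral_finsetSum _ hs]
    have hconst : ∀ v : ℝ, (k : ℝ) * v = ∑ _b : Fin k, v := fun v => by simp
    rw [hconst]
    refine Finset.sum_le_sum fun b _ => ?_
    rw [integral_sub (hi b) (integrable_const _), integral_mul_const, integral_const_mul]
    have h1 := integral_blockSilent_ge he (fun p => hr₀.trans (hr p).1) hlam j b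
    have h2 := integral_blockHit_ge he hlam j b
    have h3 : Real.exp (-((r₀ + δ) * lam)) ≤ Real.exp (-(r (e (b, j b)) * lam)) :=
      Real.exp_le_exp.2 (by nlinarith [(hr (b, j b)).2])
    have h4 := one_sub_exp_neg_nonneg hlam
    have h5 := mul_le_mul (h3.trans h1) h2 h4 ((Real.exp_pos _).le.trans (h3.trans h1))
    have h6 := mul_le_mul_of_nonneg_left h5 hlogL
    simp only [integral_const, probReal_univ, one_smul]
    simp only [hA, hH]
    linarith

theorem ofReal_le_minimaxRisk_of_card {r : Fin n → ℝ} {lam r₀ δ s : ℝ} (hr₀ : 0 ≤ r₀)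
    (hr : ∀ i, r₀ ≤ r i) (hlam : 0 ≤ lam) (hL : 1 ≤ L) (hks : (k : ℝ) ≤ s)
    (hcard : k * L ≤ (Finset.univ.filter fun i => r i ≤ r₀ + δ).card) :
    ENNReal.ofReal (k * (Real.exp (-((r₀ + δ) * lam)) * (1 - Real.exp (-lam)) * Real.log L -
      Real.log (1 + Real.exp (δ * lam)))) ≤ minimaxRisk r s := by
  have hemb : Nonempty (Fin k × Fin L ↪ Finset.univ.filter fun i => r i ≤ r₀ + δ) :=
    Function.Embedding.nonempty_of_card_le (by
      rw [Fintype.card_prod, Fintype.card_fin, Fintype.card_fin, Fintype.card_coe]; exact hcard)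
  obtain ⟨e⟩ := hemb
  refine ofReal_le_minimaxRisk_of_blocks (e := fun p => (e p : Fin n))
    (Subtype.val_injective.comp e.injective) hr₀ (fun p => ⟨hr _, ?_⟩) hlam hL hks
  exact (Finset.mem_filter.1 (e p).2).2

end Blocks

/-! ### The sharp constant and the comparison of the two bounds -/

theorem exists_sharp_constant {r₀ : ℝ} (hr₀ : 0 < r₀) :
    ∃ C > 0, (∀ t : ℝ, 0 ≤ t → Real.exp (-(r₀ * t)) * (1 - Real.exp (-t)) ≤ C) ∧
      ∀ c < C, ∃ t : ℝ, 0 ≤ t ∧ c < Real.exp (-(r₀ * t)) * (1 - Real.exp (-t)) := by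
  set S : Set ℝ := (fun t : ℝ => Real.exp (-(r₀ * t)) * (1 - Real.exp (-t))) '' Ici 0 with hS
  have hbdd : BddAbove S := by
    refine ⟨1, ?_⟩
    rintro _ ⟨t, ht, rfl⟩
    have ht0 : (0 : ℝ) ≤ t := ht
    refine mul_le_one₀ ?_ (one_sub_exp_neg_nonneg ht0) (by linarith [Real.exp_pos (-t)])
    rw [Real.exp_le_one_iff]
    have := mul_nonneg hr₀.le ht0
    linarith
  have hmem : ∀ t : ℝ, 0 ≤ t → Real.exp (-(r₀ * t)) * (1 - Real.exp (-t)) ∈ S :=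
    fun t ht => ⟨t, ht, rfl⟩
  refine ⟨sSup S, ?_, fun t ht => le_csSup hbdd (hmem t ht), fun c hc => ?_⟩
  · refine lt_of_lt_of_le ?_ (le_csSup hbdd (hmem 1 zero_le_one))
    have : Real.exp (-1) < 1 := by simp
    exact mul_pos (Real.exp_pos _) (by linarith)
  · obtain ⟨_, ⟨t, ht, rfl⟩, h⟩ := exists_lt_of_lt_csSup ⟨_, hmem 0 le_rfl⟩ hc
    exact ⟨t, ht, h⟩

/-- When sufficiently many ratios are close to their lower bound `r₀` and `n / s` is large, the
plug-in predictive density is minimax up to the factor `1 - ε`. -/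
theorem minimaxRisk_div_maxRisk_mem_Icc {κ r₀ ε : ℝ} (hκ : κ ∈ Ioc (0 : ℝ) 1) (hr₀ : 0 < r₀)
    (hε : ε ∈ Ioo (0 : ℝ) 1) :
    ∃ δ : ℝ, 0 < δ ∧ ∀ c : ℝ, 0 < c → ∃ T : ℝ, ∀ (n : ℕ) (s : ℝ) (r : Fin n → ℝ), 1 ≤ s → s ≤ n →
      (∀ i, r₀ ≤ r i) → c * n ≤ (Finset.univ.filter fun i => r i ≤ r₀ + δ).card → T ≤ n / s →
      (minimaxRisk r s).toReal / (maxRisk r s (adaptivePredictive κ r)).toReal ∈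
        Icc (1 - ε) 1 := by
  obtain ⟨C, hC0, hC, hCsharp⟩ := exists_sharp_constant hr₀
  obtain ⟨lam, hlam, hv⟩ := hCsharp ((1 - ε) * C) (by nlinarith [hε.1])
  have hcont : Tendsto (fun δ : ℝ => Real.exp (-((r₀ + δ) * lam)) * (1 - Real.exp (-lam)))
      (𝓝[>] 0) (𝓝 (Real.exp (-(r₀ * lam)) * (1 - Real.exp (-lam)))) := by
    have h : Continuous fun δ : ℝ => Real.exp (-((r₀ + δ) * lam)) * (1 - Real.exp (-lam)) := by
      fun_prop
    have := (h.tendsto 0).mono_left (nhdsWithin_le_nhds (s := Ioi 0))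
    simpa using this
  -- By continuity, raising the ratio from `r₀` to `r₀ + δ` keeps the constant above `(1 - ε) C`.
  -- The choice of `δ` precedes that of `c`, since the proportion of usable coordinates depends on
  -- `δ`.
  obtain ⟨δ, hδa, hδ0⟩ := ((hcont.eventually_const_lt hv).and self_mem_nhdsWithin).exists
  refine ⟨δ, hδ0, fun c hc => ?_⟩
  set a := Real.exp (-((r₀ + δ) * lam)) * (1 - Real.exp (-lam)) with ha
  set K := remainderConst κ r₀
  have hK : 0 ≤ K := remainderConst_nonneg hκ.1 hr₀
  have ha0 : 0 ≤ a := mul_nonneg (Real.exp_pos _).le (one_sub_exp_neg_nonneg hlam)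
  set D := Real.log (1 + Real.exp (δ * lam))
  -- The value of `ℓ` solving `a (ℓ + log (c/2)) - D = (1 - ε) (C ℓ + K)`. Beyond it the lower bound
  -- exceeds `1 - ε` times the upper bound, because the slope `a` is the larger one.
  set ℓ₀ := ((1 - ε) * K + D - a * Real.log (c / 2)) / (a - (1 - ε) * C) with hℓ₀
  refine ⟨max (max 2 (1 / c)) (Real.exp ℓ₀), fun n s r hs hsn hr hcard hT => ?_⟩
  have hs0 : 0 < s := by linarith
  have hn0 : (0 : ℝ) < n := by linarith
  have hn : 0 < n := by exact_mod_cast hn0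
  set k := ⌊s⌋₊ with hk
  have hk1 : 1 ≤ k := Nat.le_floor (by simpa using hs)
  have hk0 : (0 : ℝ) < k := by exact_mod_cast hk1
  have hks : (k : ℝ) ≤ s := Nat.floor_le hs0.le
  have hnk : (n : ℝ) / s ≤ n / k := by gcongr
  have hT' := hT.trans hnk
  have h2 : 2 ≤ (n : ℝ) / k := (le_max_left _ _).trans ((le_max_left _ _).trans hT')
  have hc1 : 1 / c ≤ (n : ℝ) / k := (le_max_right _ _).trans ((le_max_left _ _).trans hT')
  have hexp : Real.exp ℓ₀ ≤ (n : ℝ) / k := (le_max_right _ _).trans hT'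
  set ℓ := Real.log ((n : ℝ) / k) with hℓ
  have hℓ0 : 0 < ℓ := Real.log_pos (by linarith)
  have hℓℓ : ℓ₀ ≤ ℓ := (Real.le_log_iff_exp_le (by linarith)).2 hexp
  set L := ⌊c * n / k⌋₊ with hL
  have hx1 : 1 ≤ c * n / k := by
    rw [div_le_iff₀ hc] at hc1
    calc (1 : ℝ) ≤ n / k * c := hc1
      _ = c * n / k := by ring
  have hL1 : 1 ≤ L := Nat.le_floor (by simpa using hx1)
  -- The floor of a number that is at least 1 is at least half of it.
  have hLlog : ℓ + Real.log (c / 2) ≤ Real.log L := by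
    rw [hℓ, ← Real.log_mul (by positivity) (by positivity)]
    refine Real.log_le_log (by positivity) ?_
    have h1 := Nat.lt_floor_add_one (c * n / k)
    have h3 : (1 : ℝ) ≤ L := by exact_mod_cast hL1
    have h4 : (n : ℝ) / k * (c / 2) = c * n / k / 2 := by ring
    rw [h4]
    linarith
  have hkL : k * L ≤ (Finset.univ.filter fun i => r i ≤ r₀ + δ).card := by
    have h1 : (L : ℝ) ≤ c * n / k := Nat.floor_le (by positivity)
    have h3 : (k : ℝ) * L ≤ c * n := by
      rw [le_div_iff₀ hk0] at h1; linarith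
    exact_mod_cast h3.trans hcard
  have hlow := ofReal_le_minimaxRisk_of_card (δ := δ) hr₀.le hr hlam hL1 hks hkL
  have hup := maxRisk_adaptivePredictive_le hκ hr₀ hr hs hsn hC
  have hmid := minimaxRisk_le_maxRisk_adaptive hn hκ.1 (fun i => hr₀.trans_le (hr i)) s
  rw [← hk, ← hℓ] at hup
  set U := (k : ℝ) * (C * ℓ + K)
  have hU : 0 < U := by positivity
  have hVU : (1 - ε) * U ≤ k * (a * Real.log L - D) := by
    have h1 : (1 - ε) * K + D - a * Real.log (c / 2) ≤ ℓ * (a - (1 - ε) * C) := by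
      rw [hℓ₀, div_le_iff₀ (by linarith)] at hℓℓ; exact hℓℓ
    have h3 : (1 - ε) * (C * ℓ + K) ≤ a * Real.log L - D := by
      nlinarith [mul_le_mul_of_nonneg_left hLlog ha0]
    calc (1 - ε) * U = k * ((1 - ε) * (C * ℓ + K)) := by ring
      _ ≤ _ := by gcongr
  have hmax_top : maxRisk r s (adaptivePredictive κ r) ≠ ⊤ :=
    (hup.trans_lt ENNReal.ofReal_lt_top).ne
  have hmin_top : minimaxRisk r s ≠ ⊤ := (hmid.trans_lt hmax_top.lt_top).ne
  have hmaxU : (maxRisk r s (adaptivePredictive κ r)).toReal ≤ U :=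
    ENNReal.toReal_le_of_le_ofReal hU.le hup
  have hminV : (1 - ε) * U ≤ (minimaxRisk r s).toReal :=
    hVU.trans ((ENNReal.ofReal_le_iff_le_toReal hmin_top).1 hlow)
  have hmm : (minimaxRisk r s).toReal ≤ (maxRisk r s (adaptivePredictive κ r)).toReal :=
    ENNReal.toReal_mono hmax_top hmid
  have hε1 : 0 < 1 - ε := by linarith [hε.2]
  have hpos : 0 < (maxRisk r s (adaptivePredictive κ r)).toReal :=
    (mul_pos hε1 hU).trans_le (hminV.trans hmm)
  refine ⟨?_, (div_le_one hpos).2 hmm⟩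
  rw [le_div_iff₀ hpos]
  exact (mul_le_mul_of_nonneg_left hmaxU hε1.le).trans hminV

/-! ### The random ratios -/

section Ratios

variable {Ω : Type*} [MeasurableSpace Ω] {P : Measure Ω} [IsProbabilityMeasure P]
  {G : Measure ℝ} {r : ℕ → Ω → ℝ}

theorem tendsto_frequency (hr_law : ∀ i, HasLaw (r i) G P) (hr_indep : iIndepFun r P) {B : Set ℝ}
    (hB : MeasurableSet B) :
    ∀ᵐ ω ∂P, Tendsto (fun n : ℕ => (∑ i : Fin n, B.indicator (1 : ℝ → ℝ) (r i ω)) / (n : ℝ))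
      atTop (𝓝 (G.real B)) := by
  set g : ℝ → ℝ := B.indicator 1 with hg
  have hgm : Measurable g := measurable_one.indicator hB
  have hgi : ∫ ω, g (r 0 ω) ∂P = G.real B := by
    have h := (hr_law 0).integral_comp (f := g) hgm.aestronglyMeasurable
    simp only [Function.comp_def] at h
    rw [h, hg, integral_indicator_one hB]
  have h0 : Integrable (fun ω => g (r 0 ω)) P := by
    refine Integrable.of_bound (hgm.comp_aemeasurable (hr_law 0).aemeasurable).aestronglyMeasurable
      1 (ae_of_all _ fun ω => ?_)
    by_cases h : r 0 ω ∈ B <;> simp [hg, h]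
  have hindep : Pairwise (Function.onFun (· ⟂ᵢ[P] ·) fun i ω => g (r i ω)) := fun i j hij =>
    (hr_indep.indepFun hij).comp hgm hgm
  have hident : ∀ i, IdentDistrib (fun ω => g (r i ω)) (fun ω => g (r 0 ω)) P P := fun i =>
    (IdentDistrib.mk (hr_law i).aemeasurable (hr_law 0).aemeasurable
      ((hr_law i).map_eq.trans (hr_law 0).map_eq.symm)).comp hgm
  have := strong_law_ae_real (fun i ω => g (r i ω)) h0 hindep hident
  rw [hgi] at this
  filter_upwards [this] with ω hω
  refine hω.congr fun n => ?_
  rw [Finset.sum_range]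

/-- If every `Iio t` with `t > 0` had positive mass, the strong law would almost surely produce
ratios below each `1 / (m + 1)`, against the positive infimum. -/
theorem exists_pos_measure_Iio_eq_zero (hr_law : ∀ i, HasLaw (r i) G P) (hr_indep : iIndepFun r P)
    (hr_inf : ∀ᵐ ω ∂P, 0 < ⨅ i, r i ω) : ∃ t > 0, G (Iio t) = 0 := by
  by_contra! hcon
  have hG : IsProbabilityMeasure G := (hr_law 0).isProbabilityMeasure_iff.1 inferInstance
  have h1 : ∀ m : ℕ, ∀ᵐ ω ∂P, ∃ i, r i ω < 1 / ((m : ℝ) + 1) := fun m => by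
    have hpos : 0 < G.real (Iio (1 / ((m : ℝ) + 1))) :=
      ENNReal.toReal_pos (hcon _ (by positivity)) (measure_ne_top G _)
    filter_upwards [tendsto_frequency hr_law hr_indep
      (measurableSet_Iio (a := 1 / ((m : ℝ) + 1)))] with ω hω
    obtain ⟨n, hn⟩ := (hω.eventually_const_lt hpos).exists
    by_contra! hno
    refine hn.ne' ?_
    have : ∀ i : Fin n, (Iio (1 / ((m : ℝ) + 1))).indicator (1 : ℝ → ℝ) (r i ω) = 0 := fun i =>
      Set.indicator_of_notMem (s := Iio (1 / ((m : ℝ) + 1))) (fun h => not_lt.2 (hno i) h) _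
    rw [Finset.sum_eq_zero fun i _ => this i, zero_div]
  have h2 := ae_all_iff.2 h1
  obtain ⟨ω, hω, hinf⟩ := (h2.and hr_inf).exists
  obtain ⟨m, hm⟩ := exists_nat_one_div_lt hinf
  obtain ⟨i, hi⟩ := hω m
  by_cases hb : BddBelow (range fun i => r i ω)
  · exact absurd (ciInf_le hb i) (not_le.2 (hi.trans hm))
  -- For a family unbounded below, the real `iInf` has the default value 0, which is not positive.
  · rw [Real.iInf_of_not_bddBelow hb] at hinf
    exact lt_irrefl _ hinf

/-- A positive essential infimum of the law `G`. -/
theorem exists_essential_infimum [IsProbabilityMeasure G] {t₀ : ℝ} (ht₀ : 0 < t₀)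
    (hG : G (Iio t₀) = 0) :
    ∃ r₀ > 0, G (Iio r₀) = 0 ∧ ∀ δ > 0, 0 < G.real (Iic (r₀ + δ)) := by
  set S : Set ℝ := {t | G (Iio t) = 0}
  have hbdd : BddAbove S := by
    by_contra hb
    have h1 : ∀ n : ℕ, G (Iio (n : ℝ)) = 0 := fun n => by
      obtain ⟨t, ht, hnt⟩ := not_bddAbove_iff.1 hb n
      exact measure_mono_null (Iio_subset_Iio hnt.le) ht
    have h2 : (univ : Set ℝ) = ⋃ n : ℕ, Iio (n : ℝ) := by
      refine (eq_univ_of_forall fun x => ?_).symm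
      obtain ⟨n, hn⟩ := exists_nat_gt x
      exact mem_iUnion.2 ⟨n, hn⟩
    have h3 := measure_iUnion_null h1
    rw [← h2, measure_univ] at h3
    exact one_ne_zero h3
  refine ⟨sSup S, ht₀.trans_le (le_csSup hbdd hG), ?_, fun δ hδ => ?_⟩
  · have h1 : ∀ n : ℕ, G (Iio (sSup S - 1 / ((n : ℝ) + 1))) = 0 := fun n => by
      have : sSup S - 1 / ((n : ℝ) + 1) < sSup S := by
        have : (0 : ℝ) < 1 / ((n : ℝ) + 1) := by positivity
        linarith
      obtain ⟨t, ht, htl⟩ := exists_lt_of_lt_csSup ⟨t₀, hG⟩ this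
      exact measure_mono_null (Iio_subset_Iio htl.le) ht
    refine measure_mono_null (fun x hx => ?_) (measure_iUnion_null h1)
    obtain ⟨n, hn⟩ := exists_nat_one_div_lt (sub_pos.2 (show x < sSup S from hx))
    exact mem_iUnion.2 ⟨n, show x < _ by linarith⟩
  · refine ENNReal.toReal_pos (fun h => ?_) (measure_ne_top G _)
    -- A null half-line reaching beyond `sSup S` contradicts the supremum.
    have h1 : sSup S + δ ∈ S := measure_mono_null Iio_subset_Iic_self h
    have := le_csSup hbdd h1
    linarith

/-- The proportion of ratios up to `r₀ + δ` tends to `p > 0` in probability. For large `n`, `f` can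
be far from 1 only, up to a null set, where this proportion is at least `p / 2` away from `p`; so `c
= p / 2` serves. -/
theorem tendstoInMeasure_one_of_frequency (hr_law : ∀ i, HasLaw (r i) G P)
    (hr_indep : iIndepFun r P) {r₀ : ℝ} (hGr₀ : G (Iio r₀) = 0)
    (hGδ : ∀ δ > 0, 0 < G.real (Iic (r₀ + δ))) {f : ℕ → Ω → ℝ}
    (hf : ∀ ε ∈ Ioo (0 : ℝ) 1, ∃ δ : ℝ, 0 < δ ∧ ∀ c : ℝ, 0 < c → ∀ᶠ n : ℕ in atTop, ∀ ω,
      (∀ i, r₀ ≤ r i ω) →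
      c * n ≤ (Finset.univ.filter fun i : Fin n => r i ω ≤ r₀ + δ).card →
      f n ω ∈ Icc (1 - ε) 1) :
    TendstoInMeasure P f atTop fun _ => (1 : ℝ) := by
  have hge : ∀ᵐ ω ∂P, ∀ i, r₀ ≤ r i ω := by
    refine ae_all_iff.2 fun i => ?_
    have h1 : P {ω | r i ω < r₀} = 0 := by
      rw [(hr_law i).measure_eq (p := fun t => t < r₀) measurableSet_Iio]
      exact hGr₀
    rw [ae_iff]
    simpa only [not_le] using h1
  rw [tendstoInMeasure_iff_dist]
  intro ε hε
  set ε' := min (ε / 2) (1 / 2) with hε'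
  have hε'1 : ε' ∈ Ioo (0 : ℝ) 1 :=
    ⟨lt_min (by linarith) (by norm_num), (min_le_right _ _).trans_lt (by norm_num)⟩
  have hε'2 : ε' < ε := (min_le_left _ _).trans_lt (by linarith)
  obtain ⟨δ, hδ, hmain⟩ := hf ε' hε'1
  set p := G.real (Iic (r₀ + δ)) with hp
  have hp0 : 0 < p := hGδ δ hδ
  set N : ℕ → Ω → ℝ := fun n ω =>
    (∑ i : Fin n, (Iic (r₀ + δ)).indicator (1 : ℝ → ℝ) (r i ω)) / (n : ℝ) with hN
  have hNm : ∀ n, AEStronglyMeasurable (N n) P := fun n => by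
    refine AEMeasurable.aestronglyMeasurable (AEMeasurable.div_const
      (Finset.aemeasurable_fun_sum _ fun i _ => ?_) _)
    exact (measurable_one.indicator measurableSet_Iic).comp_aemeasurable (hr_law i).aemeasurable
  have hNlim : TendstoInMeasure P N atTop fun _ => p := tendstoInMeasure_of_tendsto_ae hNm
    (tendsto_frequency hr_law hr_indep (measurableSet_Iic (a := r₀ + δ)))
  have hN0 := tendstoInMeasure_iff_dist.1 hNlim (p / 2) (by positivity)
  refine tendsto_of_tendsto_of_tendsto_of_le_of_le' tendsto_const_nhds hN0
    (Eventually.of_forall fun _ => zero_le) ?_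
  filter_upwards [hmain (p / 2) (by positivity), eventually_gt_atTop 0] with n hn hn0
  refine measure_mono_ae ?_
  filter_upwards [hge] with ω hω hbad
  have hbad' : ε ≤ dist (f n ω) 1 := hbad
  change p / 2 ≤ dist (N n ω) p
  by_contra! hlt
  rw [Real.dist_eq, abs_lt] at hlt
  have hcount : p / 2 * n ≤ (Finset.univ.filter fun i : Fin n => r i ω ≤ r₀ + δ).card := by
    have h1 : p / 2 ≤ N n ω := by linarith [hlt.1]
    rw [hN, le_div_iff₀ (by positivity)] at h1
    simpa [Set.indicator_apply] using h1
  have hres := hn ω hω hcount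
  rw [Real.dist_eq] at hbad'
  have hclose : |f n ω - 1| ≤ ε' :=
    abs_le.2 ⟨by linarith [hres.1], by linarith [hres.2, hε'1.1]⟩
  linarith

theorem eventually_le_div_of_tendsto {s : ℕ → ℝ} (hs : ∀ n : ℕ, 2 ≤ n → s n ∈ Ico (1 : ℝ) n)
    (hs_lim : Tendsto (fun n : ℕ => s n / n) atTop (𝓝 0)) (T : ℝ) :
    ∀ᶠ n : ℕ in atTop, T ≤ n / s n := by
  have hT : (0 : ℝ) < 1 / max T 1 := by positivity
  filter_upwards [hs_lim.eventually_lt_const hT, eventually_ge_atTop 2] with n hn h2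
  have hs1 : 0 < s n := by linarith [(hs n h2).1]
  have hn0 : (0 : ℝ) < n := hs1.trans (hs n h2).2
  rw [le_div_iff₀ hs1]
  rw [div_lt_div_iff₀ hn0 (by positivity)] at hn
  nlinarith [le_max_left T 1]

end Ratios

end SparsePoisson

end

theorem mainTheorem11 {Ω : Type*} [MeasurableSpace Ω] (P : Measure Ω) [IsProbabilityMeasure P]
    (G : Measure ℝ) (r : ℕ → Ω → ℝ)
    (hr_law : ∀ i, HasLaw (r i) G P) (hr_indep : iIndepFun r P)
    (hr_inf : ∀ᵐ ω ∂P, 0 < ⨅ i, r i ω)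
    (hG_sq : Integrable (fun t : ℝ => t ^ 2) G)
    (hG_inv_sq : Integrable (fun t : ℝ => (t ^ 2)⁻¹) G)
    (κ : ℝ) (hκ : κ ∈ Ioc (0 : ℝ) 1)
    (s : ℕ → ℝ) (hs : ∀ n : ℕ, 2 ≤ n → s n ∈ Ico (1 : ℝ) n)
    (hs_sup : ∃ b < (1 : ℝ), ∀ n : ℕ, 2 ≤ n → s n / n ≤ b)
    (hs_lim : Tendsto (fun n : ℕ => s n / n) atTop (𝓝 0)) :
    TendstoInMeasure P
      (fun (n : ℕ) (ω : Ω) =>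
        (SparsePoisson.minimaxRisk (fun i : Fin n => r i ω) (s n)).toReal /
          (SparsePoisson.maxRisk (fun i : Fin n => r i ω) (s n)
            (SparsePoisson.adaptivePredictive κ fun i : Fin n => r i ω)).toReal)
      atTop (fun _ => (1 : ℝ)) := by
  have hG : IsProbabilityMeasure G := (hr_law 0).isProbabilityMeasure_iff.1 inferInstance
  obtain ⟨t₀, ht₀, hGt⟩ := SparsePoisson.exists_pos_measure_Iio_eq_zero hr_law hr_indep hr_inf
  obtain ⟨r₀, hr₀, hGr₀, hGδ⟩ := SparsePoisson.exists_essential_infimum ht₀ hGt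
  refine SparsePoisson.tendstoInMeasure_one_of_frequency hr_law hr_indep hGr₀ hGδ fun ε hε => ?_
  obtain ⟨δ, hδ, hmain⟩ := SparsePoisson.minimaxRisk_div_maxRisk_mem_Icc hκ hr₀ hε
  refine ⟨δ, hδ, fun c hc => ?_⟩
  obtain ⟨T, hT⟩ := hmain c hc
  filter_upwards [SparsePoisson.eventually_le_div_of_tendsto hs hs_lim T, eventually_ge_atTop 2]
    with n hnT hn2 ω hω hcount
  exact hT n (s n) (fun i => r i ω) (hs n hn2).1 (hs n hn2).2.le (fun i => hω i) hcount hnT
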